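/- All graphs are finite and loopless; parallel edges are allowed. Let $\ell\ge 2$ be an integer. For a graph $G$ let $e(G)$ be its number of edges, $\delta(G)$ its minimum degree, $d(v)$ the degree of a vertex $v$, $d(S)$ the number of edges with exactly one end in $S\subseteq V(G)$, $\mu_G(x,y)$ the number of edges joining $x$ and $y$, and $\mu(G)=\max_{x,y\in V(G)}\mu_G(x,y)$. A $\mathbb{Z}_{2\ell}$-boundary of $G$ is a map $\beta\colon V(G)\to\{0,1,\dots,2\ell-1\}$ with $\beta(v)\equiv d(v)\pmod 2$ for every vertex $v$ and $\sum_{v\in V(G)}\beta(v)\equiv 0\pmod{2\ell}$. The graph $G$ is strongly $\mathbb{Z}_\ell$-connected if for every $\mathbb{Z}_{2\ell}$-boundary $\beta$ of $G$ there is an orientation $D$ of $G$ with $d_D^+(v)-d_D^-(v)\equiv\beta(v)\pmod{2\ell}$ for every vertex $v$, where $d_D^+(v)$ and $d_D^-(v)$ are the numbers of arcs with tail $v$ and with head $v$. Theorem. Let $G_0$ be a graph with exactly $4$ vertices, and let $G$ be its simplified graph, that is, the graph on the same vertex set with $\mu_G(x,y)=\min\{\mu_{G_0}(x,y),\,\ell-1\}$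 for all $x\ne y$. Then $G_0$ is strongly $\mathbb{Z}_\ell$-connected if and only if $\delta(G)\ge \ell-1$, $e(G)\ge 3\ell-3$, and at least one of the following holds: 1. $\mu(G)=\ell-1$ or $e(G)\ge 3\ell-2$; 2. there is a set $S\subseteq V(G)$ with $|S|=2$ and $d(S)\ne 2\ell-2$; 3. there is a vertex $v\in V(G)$ with $d(v)\not\equiv \ell\pmod 2$. -/

import Mathlib

namespace Graph

variable {α β γ : Type*}

/-- `[X, Y]_G`: the edges with one end in `X` and the other end in `Y`. -/
def edgesBetween (G : Graph α β) (X Y : Set α) : Set β :=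
  {e | ∃ x ∈ X, ∃ y ∈ Y, G.IsLink e x y}

/-- `μ_G(x, y)`: the number of edges joining `x` and `y`. -/
noncomputable def pairMultiplicity (G : Graph α β) (x y : α) : ℕ :=
  (G.edgesBetween {x} {y}).ncard

/-- `μ(G)`: the largest multiplicity of a pair of vertices (a maximum, for finite graphs). -/
noncomputable def multiplicity (G : Graph α β) : ℕ :=
  sSup {m | ∃ x ∈ G.vertexSet, ∃ y ∈ G.vertexSet, G.pairMultiplicity x y = m}

/-- `e(G)`: the number of edges. -/
noncomputable def numEdges (G : Graph α β) : ℕ :=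
  G.edgeSet.ncard

/-- `d(v)`: the number of edges at `v`, a loop being counted twice. -/
noncomputable def vertexDegree (G : Graph α β) (v : α) : ℕ :=
  (G.incidenceSet v).ncard + (G.loopSet v).ncard

/-- `δ(G)`: the minimum degree. -/
noncomputable def minVertexDegree (G : Graph α β) : ℕ :=
  sInf (G.vertexDegree '' G.vertexSet)

/-- `d(S)`: the number of edges between `S` and its complement. -/
noncomputable def setDegree (G : Graph α β) (S : Set α) : ℕ :=
  (G.edgesBetween S (G.vertexSet \ S)).ncard

/-- An orientation of `G`: every edge is directed from one of its ends, its tail, to the other. -/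
structure Orientation (G : Graph α β) where
  tail : G.edgeSet → α
  head : G.edgeSet → α
  isLink : ∀ e : G.edgeSet, G.IsLink e (tail e) (head e)

/-- `d_D^+(v)`: the number of arcs with tail `v`. -/
noncomputable def Orientation.outDegree {G : Graph α β} (D : G.Orientation) (v : α) : ℕ :=
  {e | D.tail e = v}.ncard

/-- `d_D^-(v)`: the number of arcs with head `v`. -/
noncomputable def Orientation.inDegree {G : Graph α β} (D : G.Orientation) (v : α) : ℕ :=
  {e | D.head e = v}.ncard

/-- `b` is a parity-compliant `ℤ_{2ℓ}`-boundary of the (finite) graph `G`.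
Only the values of `b` at the vertices of `G` matter. -/
structure IsBoundary (G : Graph α β) (ℓ : ℕ) (b : α → ℕ) : Prop where
  lt : ∀ v ∈ G.vertexSet, b v < 2 * ℓ
  parity : ∀ v ∈ G.vertexSet, b v ≡ G.vertexDegree v [MOD 2]
  sum : ∑ᶠ v ∈ G.vertexSet, b v ≡ 0 [MOD 2 * ℓ]

/-- `D` is a `b`-orientation: out-degree minus in-degree is `b` modulo `2ℓ` at every vertex. -/
def Orientation.IsBoundaryOrientation {G : Graph α β} (D : G.Orientation) (ℓ : ℕ) (b : α → ℕ) :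
    Prop :=
  ∀ v ∈ G.vertexSet,
    (D.outDegree v : ℤ) - (D.inDegree v : ℤ) ≡ (b v : ℤ) [ZMOD 2 * (ℓ : ℤ)]

/-- The (finite) graph `G` is strongly `ℤ_ℓ`-connected. -/
def StronglyZConnected (G : Graph α β) (ℓ : ℕ) : Prop :=
  ∀ b : α → ℕ, G.IsBoundary ℓ b → ∃ D : G.Orientation, D.IsBoundaryOrientation ℓ b

/-- `G` is a simplified graph of `G₀` with respect to `ℓ`: a finite loopless graph on the same
vertices in which every multiplicity that is at least `ℓ - 1` has been replaced by `ℓ - 1`, all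
other multiplicities being unchanged. (The edges of `G` may be named at will.) -/
structure IsSimplifiedGraph (ℓ : ℕ) (G₀ : Graph α β) (G : Graph α γ) : Prop where
  vertexSet_eq : G.vertexSet = G₀.vertexSet
  edgeSet_finite : G.edgeSet.Finite
  loopless : G.Loopless
  pairMultiplicity_eq : ∀ x ∈ G₀.vertexSet, ∀ y ∈ G₀.vertexSet, x ≠ y →
    G.pairMultiplicity x y = min (G₀.pairMultiplicity x y) (ℓ - 1)

end Graph

/-! A loopless graph on four labelled vertices amounts to six multiplicities `m`. An orientation
amounts, up to the choice of edges, to numbers `0 ≤ y ≤ m` of arcs from the lower to the higher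
vertex of each pair. Net out-degrees are then twice the net flow of `y` minus a constant with the
parity of the degree. Congruences modulo `2ℓ` therefore halve to congruences modulo `ℓ`, and strong
connectivity becomes `FlowsCover` (`stronglyZConnected_iff_flowsCover`). There `y` matters only
modulo `ℓ`, so multiplicities may be cut off at `ℓ - 1` (`flowsCover_min_iff`).

Sufficiency: by Hakimi's theorem (`IsOutFeasible.exists_flow`), a zero-sum vector of the right
parity is realised once its sums over single vertices and pairs are bounded by the corresponding
cuts. Take representatives in `[-ℓ, ℓ]`. Unless all have absolute value `ℓ`, their sum is `0` or
`±2ℓ`, and translating at most three of them by `±2ℓ` repairs sum and cuts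
(`IsDense.hasNetBoundedShift`). If all have absolute value `ℓ`, the signs are free, and a cut of
size at least `2ℓ` lets both positive values lie on one side. Such a cut is missing only if every
degree has the parity of `ℓ` and all three cuts equal `2ℓ - 2`.

Necessity: the flows at one vertex must meet every residue (`le_deg`); out-degree `-1` modulo `ℓ` at
three vertices needs `3ℓ - 3` edges (`le_numEdges`); net out-degree `ℓ` at all four vertices is
impossible in the exceptional case (`cut_ne`). -/

namespace Graph

/-- Net out-degrees `r` obey the degree bounds `d` and the cut bounds `c` of a graph
on four vertices. -/
def IsNetBounded (d₁ d₂ d₃ d₄ c₁₂ c₁₃ c₁₄ r₁ r₂ r₃ r₄ : ℤ) : Prop :=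
  r₁ + r₂ + r₃ + r₄ = 0 ∧ (|r₁| ≤ d₁ ∧ |r₂| ≤ d₂ ∧ |r₃| ≤ d₃ ∧ |r₄| ≤ d₄) ∧
    |r₁ + r₂| ≤ c₁₂ ∧ |r₁ + r₃| ≤ c₁₃ ∧ |r₁ + r₄| ≤ c₁₄

/-- Some translate of `r` by multiples of `2ℓ` obeys the degree and cut bounds. -/
def HasNetBoundedShift (ℓ d₁ d₂ d₃ d₄ c₁₂ c₁₃ c₁₄ r₁ r₂ r₃ r₄ : ℤ) : Prop :=
  ∃ t₁ t₂ t₃ t₄ : ℤ, IsNetBounded d₁ d₂ d₃ d₄ c₁₂ c₁₃ c₁₄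
    (r₁ + 2 * ℓ * t₁) (r₂ + 2 * ℓ * t₂) (r₃ + 2 * ℓ * t₃) (r₄ + 2 * ℓ * t₄)

/-- The inequalities between degrees `d` and cuts `c` of a graph on four vertices with minimum
degree at least `ℓ - 1`, at least `3ℓ - 3` edges and multiplicities at most `ℓ - 1`, together
with the parity of the net out-degrees `r`. -/
structure IsDense (ℓ d₁ d₂ d₃ d₄ c₁₂ c₁₃ c₁₄ r₁ r₂ r₃ r₄ : ℤ) : Prop where
  two_le : 2 ≤ ℓ
  deg : ℓ - 1 ≤ d₁ ∧ ℓ - 1 ≤ d₂ ∧ ℓ - 1 ≤ d₃ ∧ ℓ - 1 ≤ d₄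
  cut : ℓ - 1 ≤ c₁₂ ∧ ℓ - 1 ≤ c₁₃ ∧ ℓ - 1 ≤ c₁₄
  sum_eq : d₁ + d₂ + d₃ + d₄ = c₁₂ + c₁₃ + c₁₄
  sum_ge : 6 * ℓ - 6 ≤ c₁₂ + c₁₃ + c₁₄
  two_cuts : 3 * ℓ - 3 ≤ c₁₂ + c₁₃ ∧ 3 * ℓ - 3 ≤ c₁₂ + c₁₄ ∧ 3 * ℓ - 3 ≤ c₁₃ + c₁₄
  pair_cut : (4 * ℓ - 4 ≤ d₁ + d₂ + c₁₂ ∧ 4 * ℓ - 4 ≤ d₃ + d₄ + c₁₂) ∧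
    (4 * ℓ - 4 ≤ d₁ + d₃ + c₁₃ ∧ 4 * ℓ - 4 ≤ d₂ + d₄ + c₁₃) ∧
    (4 * ℓ - 4 ≤ d₁ + d₄ + c₁₄ ∧ 4 * ℓ - 4 ≤ d₂ + d₃ + c₁₄)
  pair_cuts : (6 * ℓ - 6 ≤ d₁ + d₂ + c₁₃ + c₁₄ ∧ 6 * ℓ - 6 ≤ d₃ + d₄ + c₁₃ + c₁₄) ∧
    (6 * ℓ - 6 ≤ d₁ + d₃ + c₁₂ + c₁₄ ∧ 6 * ℓ - 6 ≤ d₂ + d₄ + c₁₂ + c₁₄) ∧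
    (6 * ℓ - 6 ≤ d₁ + d₄ + c₁₂ + c₁₃ ∧ 6 * ℓ - 6 ≤ d₂ + d₃ + c₁₂ + c₁₃)
  parity : (2 ∣ d₁ - r₁ ∧ 2 ∣ d₂ - r₂ ∧ 2 ∣ d₃ - r₃ ∧ 2 ∣ d₄ - r₄) ∧
    2 ∣ c₁₂ - (r₁ + r₂) ∧ 2 ∣ c₁₃ - (r₁ + r₃) ∧ 2 ∣ c₁₄ - (r₁ + r₄)
  range : (-ℓ ≤ r₁ ∧ -ℓ ≤ r₂ ∧ -ℓ ≤ r₃ ∧ -ℓ ≤ r₄) ∧ (r₁ ≤ ℓ ∧ r₂ ≤ ℓ ∧ r₃ ≤ ℓ ∧ r₄ ≤ ℓ)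

/-! ### Symmetries under relabelling and reversal. -/

variable {ℓ d₁ d₂ d₃ d₄ c₁₂ c₁₃ c₁₄ r₁ r₂ r₃ r₄ : ℤ}

theorem IsNetBounded.of_swap₁₂ (h : IsNetBounded d₂ d₁ d₃ d₄ c₁₂ c₁₄ c₁₃ r₂ r₁ r₃ r₄) :
    IsNetBounded d₁ d₂ d₃ d₄ c₁₂ c₁₃ c₁₄ r₁ r₂ r₃ r₄ := by
  simp only [IsNetBounded, abs_le] at *; omega

theorem IsNetBounded.of_swap₂₃ (h : IsNetBounded d₁ d₃ d₂ d₄ c₁₃ c₁₂ c₁₄ r₁ r₃ r₂ r₄) :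
    IsNetBounded d₁ d₂ d₃ d₄ c₁₂ c₁₃ c₁₄ r₁ r₂ r₃ r₄ := by
  simp only [IsNetBounded, abs_le] at *; omega

theorem IsNetBounded.of_swap₃₄ (h : IsNetBounded d₁ d₂ d₄ d₃ c₁₂ c₁₄ c₁₃ r₁ r₂ r₄ r₃) :
    IsNetBounded d₁ d₂ d₃ d₄ c₁₂ c₁₃ c₁₄ r₁ r₂ r₃ r₄ := by
  simp only [IsNetBounded, abs_le] at *; omega

theorem IsNetBounded.of_neg (h : IsNetBounded d₁ d₂ d₃ d₄ c₁₂ c₁₃ c₁₄ (-r₁) (-r₂) (-r₃) (-r₄)) :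
    IsNetBounded d₁ d₂ d₃ d₄ c₁₂ c₁₃ c₁₄ r₁ r₂ r₃ r₄ := by
  simp only [IsNetBounded, abs_le] at *; omega

theorem HasNetBoundedShift.of_swap₁₂
    (h : HasNetBoundedShift ℓ d₂ d₁ d₃ d₄ c₁₂ c₁₄ c₁₃ r₂ r₁ r₃ r₄) :
    HasNetBoundedShift ℓ d₁ d₂ d₃ d₄ c₁₂ c₁₃ c₁₄ r₁ r₂ r₃ r₄ :=
  let ⟨t₂, t₁, t₃, t₄, ht⟩ := h
  ⟨t₁, t₂, t₃, t₄, ht.of_swap₁₂⟩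

theorem HasNetBoundedShift.of_swap₂₃
    (h : HasNetBoundedShift ℓ d₁ d₃ d₂ d₄ c₁₃ c₁₂ c₁₄ r₁ r₃ r₂ r₄) :
    HasNetBoundedShift ℓ d₁ d₂ d₃ d₄ c₁₂ c₁₃ c₁₄ r₁ r₂ r₃ r₄ :=
  let ⟨t₁, t₃, t₂, t₄, ht⟩ := h
  ⟨t₁, t₂, t₃, t₄, ht.of_swap₂₃⟩

theorem HasNetBoundedShift.of_swap₃₄
    (h : HasNetBoundedShift ℓ d₁ d₂ d₄ d₃ c₁₂ c₁₄ c₁₃ r₁ r₂ r₄ r₃) :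
    HasNetBoundedShift ℓ d₁ d₂ d₃ d₄ c₁₂ c₁₃ c₁₄ r₁ r₂ r₃ r₄ :=
  let ⟨t₁, t₂, t₄, t₃, ht⟩ := h
  ⟨t₁, t₂, t₃, t₄, ht.of_swap₃₄⟩

theorem HasNetBoundedShift.of_neg
    (h : HasNetBoundedShift ℓ d₁ d₂ d₃ d₄ c₁₂ c₁₃ c₁₄ (-r₁) (-r₂) (-r₃) (-r₄)) :
    HasNetBoundedShift ℓ d₁ d₂ d₃ d₄ c₁₂ c₁₃ c₁₄ r₁ r₂ r₃ r₄ := by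
  obtain ⟨t₁, t₂, t₃, t₄, ht⟩ := h
  refine ⟨-t₁, -t₂, -t₃, -t₄, IsNetBounded.of_neg ?_⟩
  convert ht using 1 <;> ring

/-- The cuts are named by their side containing vertex 1. The swap passes to complementary sides,
whose parities agree only because the total is even. -/
theorem IsDense.swap₁₂ (h : IsDense ℓ d₁ d₂ d₃ d₄ c₁₂ c₁₃ c₁₄ r₁ r₂ r₃ r₄)
    (h2 : 2 ∣ r₁ + r₂ + r₃ + r₄) : IsDense ℓ d₂ d₁ d₃ d₄ c₁₂ c₁₄ c₁₃ r₂ r₁ r₃ r₄ where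
  two_le := h.two_le
  deg := by have := h.deg; omega
  cut := by have := h.cut; omega
  sum_eq := by have := h.sum_eq; omega
  sum_ge := by have := h.sum_ge; omega
  two_cuts := by have := h.two_cuts; omega
  pair_cut := by have := h.pair_cut; omega
  pair_cuts := by have := h.pair_cuts; omega
  parity := by have := h.parity; omega
  range := by have := h.range; omega

theorem IsDense.swap₂₃ (h : IsDense ℓ d₁ d₂ d₃ d₄ c₁₂ c₁₃ c₁₄ r₁ r₂ r₃ r₄) :
    IsDense ℓ d₁ d₃ d₂ d₄ c₁₃ c₁₂ c₁₄ r₁ r₃ r₂ r₄ where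
  two_le := h.two_le
  deg := by have := h.deg; omega
  cut := by have := h.cut; omega
  sum_eq := by have := h.sum_eq; omega
  sum_ge := by have := h.sum_ge; omega
  two_cuts := by have := h.two_cuts; omega
  pair_cut := by have := h.pair_cut; omega
  pair_cuts := by have := h.pair_cuts; omega
  parity := by have := h.parity; omega
  range := by have := h.range; omega

theorem IsDense.swap₃₄ (h : IsDense ℓ d₁ d₂ d₃ d₄ c₁₂ c₁₃ c₁₄ r₁ r₂ r₃ r₄) :
    IsDense ℓ d₁ d₂ d₄ d₃ c₁₂ c₁₄ c₁₃ r₁ r₂ r₄ r₃ where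
  two_le := h.two_le
  deg := by have := h.deg; omega
  cut := by have := h.cut; omega
  sum_eq := by have := h.sum_eq; omega
  sum_ge := by have := h.sum_ge; omega
  two_cuts := by have := h.two_cuts; omega
  pair_cut := by have := h.pair_cut; omega
  pair_cuts := by have := h.pair_cuts; omega
  parity := by have := h.parity; omega
  range := by have := h.range; omega

theorem IsDense.neg (h : IsDense ℓ d₁ d₂ d₃ d₄ c₁₂ c₁₃ c₁₄ r₁ r₂ r₃ r₄) :
    IsDense ℓ d₁ d₂ d₃ d₄ c₁₂ c₁₃ c₁₄ (-r₁) (-r₂) (-r₃) (-r₄) where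
  two_le := h.two_le
  deg := by have := h.deg; omega
  cut := by have := h.cut; omega
  sum_eq := by have := h.sum_eq; omega
  sum_ge := by have := h.sum_ge; omega
  two_cuts := by have := h.two_cuts; omega
  pair_cut := by have := h.pair_cut; omega
  pair_cuts := by have := h.pair_cuts; omega
  parity := by have := h.parity; omega
  range := by have := h.range; omega

/-- The range gives only `-ℓ`, but a degree `ℓ - 1` has the wrong parity for `r = -ℓ`. -/
theorem IsDense.neg_deg_le (h : IsDense ℓ d₁ d₂ d₃ d₄ c₁₂ c₁₃ c₁₄ r₁ r₂ r₃ r₄) :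
    (-d₁ ≤ r₁ ∧ -d₂ ≤ r₂) ∧ -d₃ ≤ r₃ ∧ -d₄ ≤ r₄ := by
  have h1 := h.deg
  have h2 := h.parity.1
  have h3 := h.range.1
  omega

theorem IsDense.le_deg (h : IsDense ℓ d₁ d₂ d₃ d₄ c₁₂ c₁₃ c₁₄ r₁ r₂ r₃ r₄) :
    (r₁ ≤ d₁ ∧ r₂ ≤ d₂) ∧ r₃ ≤ d₃ ∧ r₄ ≤ d₄ := by
  have h1 := h.deg
  have h2 := h.parity.1
  have h3 := h.range.2
  omega

/-! ### Elementary translations by `2ℓ`. -/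

theorem add_two_le_of_lt_of_even_sub {a b : ℤ} (h : a < b) (hd : 2 ∣ a - b) : a + 2 ≤ b := by
  omega

/-- Lowering the net out-degree of one vertex by `2ℓ`. -/
theorem IsDense.shift_one (h : IsDense ℓ d₁ d₂ d₃ d₄ c₁₂ c₁₃ c₁₄ r₁ r₂ r₃ r₄)
    (hs : r₁ + r₂ + r₃ + r₄ = 2 * ℓ) (h1 : 2 * ℓ ≤ d₁ + r₁) (h12 : r₃ + r₄ ≤ c₁₂)
    (h13 : r₂ + r₄ ≤ c₁₃) (h14 : r₂ + r₃ ≤ c₁₄) :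
    HasNetBoundedShift ℓ d₁ d₂ d₃ d₄ c₁₂ c₁₃ c₁₄ r₁ r₂ r₃ r₄ := by
  obtain ⟨⟨_, _⟩, _, _⟩ := h.neg_deg_le
  obtain ⟨⟨_, _⟩, _, _⟩ := h.le_deg
  obtain ⟨_, ⟨_, _, _, _⟩, ⟨_, _, _⟩, _, _, ⟨_, _, _⟩, ⟨⟨_, _⟩, ⟨_, _⟩, _, _⟩, ⟨⟨_, _⟩, ⟨_, _⟩, _, _⟩,
    ⟨⟨_, _, _, _⟩, _, _, _⟩, ⟨_, _, _, _⟩, _, _, _, _⟩ := h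
  refine ⟨-1, 0, 0, 0, ?_⟩
  simp only [IsNetBounded, abs_le]
  and_intros <;> linarith

/-- Lowering the net out-degrees of two vertices by `2ℓ` and raising that of a third one. -/
theorem IsDense.shift_three (h : IsDense ℓ d₁ d₂ d₃ d₄ c₁₂ c₁₃ c₁₄ r₁ r₂ r₃ r₄)
    (hs : r₁ + r₂ + r₃ + r₄ = 2 * ℓ) (h4 : -ℓ < r₄) (h1 : d₁ + r₁ < 2 * ℓ)
    (h12 : c₁₂ < r₁ + r₂) (h13 : c₁₃ < r₁ + r₃) :
    HasNetBoundedShift ℓ d₁ d₂ d₃ d₄ c₁₂ c₁₃ c₁₄ r₁ r₂ r₃ r₄ := by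
  have := add_two_le_of_lt_of_even_sub h12 h.parity.2.1
  have := add_two_le_of_lt_of_even_sub h13 h.parity.2.2.1
  have : d₁ + r₁ + 2 ≤ 2 * ℓ := by have := h.parity.1; omega
  have : r₁ < ℓ := by have := h.deg; omega
  obtain ⟨⟨_, _⟩, _, _⟩ := h.neg_deg_le
  obtain ⟨⟨_, _⟩, _, _⟩ := h.le_deg
  obtain ⟨_, ⟨_, _, _, _⟩, ⟨_, _, _⟩, _, _, ⟨_, _, _⟩, ⟨⟨_, _⟩, ⟨_, _⟩, _, _⟩, ⟨⟨_, _⟩, ⟨_, _⟩, _, _⟩,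
    ⟨⟨_, _, _, _⟩, _, _, _⟩, ⟨_, _, _, _⟩, _, _, _, _⟩ := h
  -- The two violated cuts and the smallness of `d₁ + r₁` turn `pair_cut` into room for lowering
  -- vertices 2 and 3, and `pair_cuts` into room for raising vertex 4.
  refine ⟨0, -1, -1, 1, ?_⟩
  simp only [IsNetBounded, abs_le]
  and_intros <;> linarith

/-- Lowering the net out-degree of one of the vertices `1`, `2` by `2ℓ` and raising that of one of
the vertices `3`, `4`. -/
theorem IsDense.shift_two (h : IsDense ℓ d₁ d₂ d₃ d₄ c₁₂ c₁₃ c₁₄ r₁ r₂ r₃ r₄)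
    (hs : r₁ + r₂ + r₃ + r₄ = 0) (h12 : c₁₂ < r₁ + r₂)
    (hne : ¬ (r₁ = ℓ ∧ r₂ = ℓ)) (h1 : 2 * ℓ ≤ d₁ + r₁) (h3 : 2 * ℓ ≤ d₃ - r₃) :
    HasNetBoundedShift ℓ d₁ d₂ d₃ d₄ c₁₂ c₁₃ c₁₄ r₁ r₂ r₃ r₄ := by
  have := add_two_le_of_lt_of_even_sub h12 h.parity.2.1
  -- The alternatives lower 1 or 2 and raise 3 or 4, in the order 1–3, 1–4, 2–3, 2–4. If all fail,
  -- the failed inequalities, the violated cut and the lower bounds on total cuts leave only `r₁ =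
  -- r₂ = ℓ`, which `hne` excludes.
  have key : 2 * ℓ ≤ c₁₄ + r₁ + r₄ ∨
      (2 * ℓ ≤ d₄ - r₄ ∧ 2 * ℓ ≤ c₁₃ + r₁ + r₃) ∨
      (2 * ℓ ≤ d₂ + r₂ ∧ 2 * ℓ ≤ c₁₃ - (r₁ + r₃)) ∨
      (2 * ℓ ≤ d₂ + r₂ ∧ 2 * ℓ ≤ d₄ - r₄ ∧ 2 * ℓ ≤ c₁₄ - (r₁ + r₄)) := by
    have h4 : r₄ ≤ -ℓ → 2 * ℓ ≤ d₄ - r₄ := by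
      have := h.parity.1; have := h.deg; have := h.range.1; omega
    have h2 : ℓ ≤ r₂ → 2 * ℓ ≤ d₂ + r₂ := by
      have := h.parity.1; have := h.deg; have := h.range.1; omega
    have h2' : d₂ + r₂ < 2 * ℓ → d₂ + r₂ + 2 ≤ 2 * ℓ := by have := h.parity.1; omega
    have h4' : d₄ - r₄ < 2 * ℓ → d₄ - r₄ + 2 ≤ 2 * ℓ := by have := h.parity.1; omega
    have h14 : c₁₄ + r₁ + r₄ < 2 * ℓ → c₁₄ + r₁ + r₄ + 2 ≤ 2 * ℓ := by
      have := h.parity.2; omega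
    have h14' : c₁₄ - (r₁ + r₄) < 2 * ℓ → c₁₄ - (r₁ + r₄) + 2 ≤ 2 * ℓ := by
      have := h.parity.2; omega
    have h24 := h.pair_cuts.2.1.2
    have hge := h.sum_ge
    have hrange := h.range
    clear h
    by_contra! hcon
    obtain ⟨k₁, k₂, k₃, k₄⟩ := hcon
    replace k₁ := h14 (by linarith)
    by_cases o₂ : 2 * ℓ ≤ d₂ + r₂
    · have r4 : r₄ ≤ -ℓ := by have := k₃ o₂; omega
      have o₄ := h4 r4
      have := k₂ o₄
      have := h14' (k₄ o₂ o₄)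
      omega
    · have := h2' (by omega)
      by_cases o₄ : 2 * ℓ ≤ d₄ - r₄
      · have := k₂ o₄
        exact o₂ (h2 (by omega))
      · have := h4' (by omega)
        omega
  obtain ⟨⟨_, _⟩, _, _⟩ := h.neg_deg_le
  obtain ⟨⟨_, _⟩, _, _⟩ := h.le_deg
  obtain ⟨_, ⟨_, _, _, _⟩, ⟨_, _, _⟩, _, _, ⟨_, _, _⟩, ⟨⟨_, _⟩, ⟨_, _⟩, _, _⟩, ⟨⟨_, _⟩, ⟨_, _⟩, _, _⟩,
    ⟨⟨_, _, _, _⟩, _, _, _⟩, ⟨_, _, _, _⟩, _, _, _, _⟩ := h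
  -- Each move changes two of the cut values and fixes the third. The fixed one obeys its bound: by
  -- `two_cuts`, two violated cuts would make two coordinates differ by more than `2ℓ`.
  rcases key with k | ⟨_, k⟩ | ⟨_, k⟩ | ⟨_, _, k⟩
  · refine ⟨-1, 0, 1, 0, ?_⟩
    simp only [IsNetBounded, abs_le]
    and_intros <;> linarith
  · refine ⟨-1, 0, 0, 1, ?_⟩
    simp only [IsNetBounded, abs_le]
    and_intros <;> linarith
  · refine ⟨0, -1, 1, 0, ?_⟩
    simp only [IsNetBounded, abs_le]
    and_intros <;> linarith
  · refine ⟨0, -1, 0, 1, ?_⟩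
    simp only [IsNetBounded, abs_le]
    and_intros <;> linarith
end Graph

/-! ### Existence of a translate within the bounds. -/

namespace Graph
variable {ℓ d₁ d₂ d₃ d₄ c₁₂ c₁₃ c₁₄ r₁ r₂ r₃ r₄ : ℤ}

/-- What the failure of `shift_one` and `shift_three` leaves. Call a pair overfull if its net
out-degree exceeds its cut: a vertex that may be lowered is blocked by an overfull pair among the
other three, and any other vertex lies in at most one overfull pair. -/
theorem IsDense.exists_lt_of_not_hasNetBoundedShift
    (h : IsDense ℓ d₁ d₂ d₃ d₄ c₁₂ c₁₃ c₁₄ r₁ r₂ r₃ r₄) (hs : r₁ + r₂ + r₃ + r₄ = 2 * ℓ)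
    (hr : -ℓ < r₂ ∧ -ℓ < r₃ ∧ -ℓ < r₄)
    (hn : ¬ HasNetBoundedShift ℓ d₁ d₂ d₃ d₄ c₁₂ c₁₃ c₁₄ r₁ r₂ r₃ r₄) :
    (2 * ℓ ≤ d₁ + r₁ → c₁₂ < r₃ + r₄ ∨ c₁₃ < r₂ + r₄ ∨ c₁₄ < r₂ + r₃) ∧
    (d₁ + r₁ < 2 * ℓ → (r₁ + r₂ ≤ c₁₂ ∨ r₁ + r₃ ≤ c₁₃) ∧ (r₁ + r₂ ≤ c₁₂ ∨ r₁ + r₄ ≤ c₁₄) ∧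
      (r₁ + r₃ ≤ c₁₃ ∨ r₁ + r₄ ≤ c₁₄)) := by
  refine ⟨fun h1 ↦ ?_, fun h1 ↦ ⟨?_, ?_, ?_⟩⟩ <;> by_contra! hc <;> apply hn
  · exact h.shift_one hs h1 hc.1 hc.2.1 hc.2.2
  · exact h.shift_three hs hr.2.2 h1 hc.1 hc.2
  · exact (h.swap₃₄.shift_three (by linarith) hr.2.1 h1 hc.1 hc.2).of_swap₃₄
  · exact (h.swap₂₃.swap₃₄.shift_three (by linarith) hr.1 h1 hc.1 hc.2).of_swap₃₄.of_swap₂₃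

/-- Complementary pairs cannot both be overfull, since they sum to `2ℓ` and cuts are at least `ℓ -
1`. Blocking vertex 2 thus gives a second overfull pair at vertex 3, so vertex 3 may be lowered as
well. Blocking it completes a triangle of overfull pairs, and `sum_ge` then pushes the fourth value
down to `-ℓ`. -/
theorem IsDense.hasNetBoundedShift_of_two_le_add
    (h : IsDense ℓ d₁ d₂ d₃ d₄ c₁₂ c₁₃ c₁₄ r₁ r₂ r₃ r₄) (hs : r₁ + r₂ + r₃ + r₄ = 2 * ℓ)
    (hr : (-ℓ < r₁ ∧ -ℓ < r₂) ∧ -ℓ < r₃ ∧ -ℓ < r₄) (h2 : 2 * ℓ ≤ d₂ + r₂)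
    (h23 : c₁₄ < r₂ + r₃) :
    HasNetBoundedShift ℓ d₁ d₂ d₃ d₄ c₁₂ c₁₃ c₁₄ r₁ r₂ r₃ r₄ := by
  by_contra hn
  have p : 2 ∣ r₁ + r₂ + r₃ + r₄ := ⟨ℓ, hs⟩
  have f2 := ((h.swap₁₂ p).exists_lt_of_not_hasNetBoundedShift (by linarith)
    (by omega) fun h ↦ hn h.of_swap₁₂).1 h2
  obtain ⟨f3, g3⟩ := (h.swap₂₃.swap₁₂ (by omega)).exists_lt_of_not_hasNetBoundedShift (by linarith)
    (by omega) fun h ↦ hn h.of_swap₁₂.of_swap₂₃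
  have hc := h.cut
  have hge := h.sum_ge
  have hp := h.parity.2
  have hl := h.two_le
  clear h
  have b14 : c₁₄ + 2 ≤ r₂ + r₃ := by omega
  have h14 : r₁ + r₄ ≤ c₁₄ := by omega
  have b : c₁₂ < r₃ + r₄ ∨ c₁₃ < r₁ + r₃ := by
    rcases f2 with h | h | h
    · exact .inl h
    · exact absurd h (by omega)
    · exact .inr h
  have h3 : 2 * ℓ ≤ d₃ + r₃ := by
    by_contra! h3
    have := g3 h3
    omega
  have f := f3 h3
  clear f2 f3 g3 hn
  rcases b with b | b
  · have b12 : c₁₂ + 2 ≤ r₃ + r₄ := by omega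
    rcases f with f | f | f
    · have : c₁₃ + 2 ≤ r₂ + r₄ := by omega
      omega
    · omega
    · omega
  · have b13 := add_two_le_of_lt_of_even_sub b hp.2.1
    rcases f with f | f | f
    · omega
    · omega
    · have : c₁₂ + 2 ≤ r₁ + r₂ := by omega
      omega

theorem IsDense.hasNetBoundedShift_of_lt
    (h : IsDense ℓ d₁ d₂ d₃ d₄ c₁₂ c₁₃ c₁₄ r₁ r₂ r₃ r₄) (hs : r₁ + r₂ + r₃ + r₄ = 2 * ℓ)
    (hr : (-ℓ < r₁ ∧ -ℓ < r₂) ∧ -ℓ < r₃ ∧ -ℓ < r₄) (h23 : c₁₄ < r₂ + r₃) :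
    HasNetBoundedShift ℓ d₁ d₂ d₃ d₄ c₁₂ c₁₃ c₁₄ r₁ r₂ r₃ r₄ := by
  by_cases h2 : 2 * ℓ ≤ d₂ + r₂
  · exact h.hasNetBoundedShift_of_two_le_add hs hr h2 h23
  -- An overfull pair contains a vertex that may be lowered: otherwise, by parity, both `d + r` are
  -- at most `2ℓ - 2`, against `pair_cut`.
  · refine (h.swap₂₃.hasNetBoundedShift_of_two_le_add (by linarith) (by omega) ?_
      (by linarith)).of_swap₂₃
    have := h.pair_cut.2.2.2
    have := h.parity
    omega

theorem IsDense.hasNetBoundedShift_of_le_add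
    (h : IsDense ℓ d₁ d₂ d₃ d₄ c₁₂ c₁₃ c₁₄ r₁ r₂ r₃ r₄) (hs : r₁ + r₂ + r₃ + r₄ = 2 * ℓ)
    (hr : (-ℓ < r₁ ∧ -ℓ < r₂) ∧ -ℓ < r₃ ∧ -ℓ < r₄) (h1 : 2 * ℓ ≤ d₁ + r₁) :
    HasNetBoundedShift ℓ d₁ d₂ d₃ d₄ c₁₂ c₁₃ c₁₄ r₁ r₂ r₃ r₄ := by
  by_cases h23 : c₁₄ < r₂ + r₃
  · exact h.hasNetBoundedShift_of_lt hs hr h23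
  by_cases h24 : c₁₃ < r₂ + r₄
  · exact (h.swap₃₄.hasNetBoundedShift_of_lt (by linarith) (by omega) h24).of_swap₃₄
  by_cases h34 : c₁₂ < r₃ + r₄
  · exact (h.swap₂₃.swap₃₄.hasNetBoundedShift_of_lt (by linarith) (by omega)
      h34).of_swap₃₄.of_swap₂₃
  exact h.shift_one hs h1 (by omega) (by omega) (by omega)

theorem IsDense.hasNetBoundedShift_of_sum_eq_two_mul
    (h : IsDense ℓ d₁ d₂ d₃ d₄ c₁₂ c₁₃ c₁₄ r₁ r₂ r₃ r₄) (hs : r₁ + r₂ + r₃ + r₄ = 2 * ℓ)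
    (hr : (-ℓ < r₁ ∧ -ℓ < r₂) ∧ -ℓ < r₃ ∧ -ℓ < r₄) :
    HasNetBoundedShift ℓ d₁ d₂ d₃ d₄ c₁₂ c₁₃ c₁₄ r₁ r₂ r₃ r₄ := by
  have p : 2 ∣ r₁ + r₂ + r₃ + r₄ := ⟨ℓ, hs⟩
  by_cases h1 : 2 * ℓ ≤ d₁ + r₁
  · exact h.hasNetBoundedShift_of_le_add hs hr h1
  by_cases h2 : 2 * ℓ ≤ d₂ + r₂
  · exact ((h.swap₁₂ p).hasNetBoundedShift_of_le_add (by linarith) (by omega) h2).of_swap₁₂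
  by_cases h3 : 2 * ℓ ≤ d₃ + r₃
  · exact ((h.swap₂₃.swap₁₂ (by omega)).hasNetBoundedShift_of_le_add (by linarith) (by omega)
      h3).of_swap₁₂.of_swap₂₃
  -- The four values `d + r` total at least `8ℓ - 6`, and by parity each one below `2ℓ` is at most
  -- `2ℓ - 2`, so they cannot all be below.
  refine ((h.swap₃₄.swap₂₃.swap₁₂ (by omega)).hasNetBoundedShift_of_le_add (by linarith)
    (by omega) ?_).of_swap₁₂.of_swap₂₃.of_swap₃₄
  have := h.sum_eq
  have := h.sum_ge
  have := h.parity.1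
  omega

theorem IsDense.hasNetBoundedShift_of_cut_lt
    (h : IsDense ℓ d₁ d₂ d₃ d₄ c₁₂ c₁₃ c₁₄ r₁ r₂ r₃ r₄) (hs : r₁ + r₂ + r₃ + r₄ = 0)
    (hne : ¬ (r₁ = ℓ ∧ r₂ = ℓ)) (h12 : c₁₂ < r₁ + r₂) :
    HasNetBoundedShift ℓ d₁ d₂ d₃ d₄ c₁₂ c₁₃ c₁₄ r₁ r₂ r₃ r₄ := by
  have o : 2 * ℓ ≤ d₁ + r₁ ∨ 2 * ℓ ≤ d₂ + r₂ := by
    have := h.pair_cut.1.1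
    have := h.parity
    omega
  have o' : 2 * ℓ ≤ d₃ - r₃ ∨ 2 * ℓ ≤ d₄ - r₄ := by
    have := h.pair_cut.1.2
    have := h.parity
    omega
  have p : 2 ∣ r₁ + r₂ + r₃ + r₄ := by omega
  rcases o with o | o <;> rcases o' with o' | o'
  · exact h.shift_two hs h12 hne o o'
  · exact (h.swap₃₄.shift_two (by linarith) h12 hne o o').of_swap₃₄
  · exact ((h.swap₁₂ p).shift_two (by linarith) (by linarith) (by tauto) o o').of_swap₁₂
  · exact ((h.swap₁₂ p).swap₃₄.shift_two (by linarith) (by linarith) (by tauto) o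
      o').of_swap₃₄.of_swap₁₂

theorem IsDense.hasNetBoundedShift_of_cut_lt_abs
    (h : IsDense ℓ d₁ d₂ d₃ d₄ c₁₂ c₁₃ c₁₄ r₁ r₂ r₃ r₄) (hs : r₁ + r₂ + r₃ + r₄ = 0)
    (hne : ¬ (|r₁| = ℓ ∧ |r₂| = ℓ ∧ |r₃| = ℓ ∧ |r₄| = ℓ)) (h12 : c₁₂ < |r₁ + r₂|) :
    HasNetBoundedShift ℓ d₁ d₂ d₃ d₄ c₁₂ c₁₃ c₁₄ r₁ r₂ r₃ r₄ := by
  have hrange := h.range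
  have := h.two_le
  rcases lt_abs.1 h12 with h12 | h12
  · refine h.hasNetBoundedShift_of_cut_lt hs ?_ h12
    contrapose! hne
    simp only [abs_eq (by linarith : 0 ≤ ℓ)]
    omega
  · refine (h.neg.hasNetBoundedShift_of_cut_lt (by linarith) ?_ (by linarith)).of_neg
    contrapose! hne
    simp only [abs_eq (by linarith : 0 ≤ ℓ)]
    omega

theorem IsDense.hasNetBoundedShift_of_sum_eq_zero
    (h : IsDense ℓ d₁ d₂ d₃ d₄ c₁₂ c₁₃ c₁₄ r₁ r₂ r₃ r₄) (hs : r₁ + r₂ + r₃ + r₄ = 0)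
    (hne : ¬ (|r₁| = ℓ ∧ |r₂| = ℓ ∧ |r₃| = ℓ ∧ |r₄| = ℓ)) :
    HasNetBoundedShift ℓ d₁ d₂ d₃ d₄ c₁₂ c₁₃ c₁₄ r₁ r₂ r₃ r₄ := by
  by_cases h12 : c₁₂ < |r₁ + r₂|
  · exact h.hasNetBoundedShift_of_cut_lt_abs hs hne h12
  by_cases h13 : c₁₃ < |r₁ + r₃|
  · exact (h.swap₂₃.hasNetBoundedShift_of_cut_lt_abs (by linarith) (by tauto) h13).of_swap₂₃
  by_cases h14 : c₁₄ < |r₁ + r₄|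
  · exact (h.swap₃₄.swap₂₃.hasNetBoundedShift_of_cut_lt_abs (by linarith) (by tauto)
      h14).of_swap₂₃.of_swap₃₄
  refine ⟨0, 0, 0, 0, ?_⟩
  simp only [mul_zero, add_zero]
  refine ⟨hs, ⟨?_, ?_, ?_, ?_⟩, not_lt.1 h12, not_lt.1 h13, not_lt.1 h14⟩ <;> rw [abs_le]
  · exact ⟨h.neg_deg_le.1.1, h.le_deg.1.1⟩
  · exact ⟨h.neg_deg_le.1.2, h.le_deg.1.2⟩
  · exact ⟨h.neg_deg_le.2.1, h.le_deg.2.1⟩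
  · exact ⟨h.neg_deg_le.2.2, h.le_deg.2.2⟩

theorem IsDense.hasNetBoundedShift
    (h : IsDense ℓ d₁ d₂ d₃ d₄ c₁₂ c₁₃ c₁₄ r₁ r₂ r₃ r₄) (hs : 2 * ℓ ∣ r₁ + r₂ + r₃ + r₄)
    (hne : ¬ (|r₁| = ℓ ∧ |r₂| = ℓ ∧ |r₃| = ℓ ∧ |r₄| = ℓ)) :
    HasNetBoundedShift ℓ d₁ d₂ d₃ d₄ c₁₂ c₁₃ c₁₄ r₁ r₂ r₃ r₄ := by
  obtain ⟨k, hk⟩ := hs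
  have hrange := h.range
  have hl := h.two_le
  simp only [abs_eq (by linarith : 0 ≤ ℓ)] at hne
  -- A total of `4ℓ` would force all values to be `ℓ`, against `hne`.
  have k1 : k < 2 := by
    by_contra! hk2
    have : 2 * ℓ * 2 ≤ 2 * ℓ * k := mul_le_mul_of_nonneg_left hk2 (by linarith)
    omega
  have k2 : -2 < k := by
    by_contra! hk2
    have : 2 * ℓ * k ≤ 2 * ℓ * (-2) := mul_le_mul_of_nonneg_left hk2 (by linarith)
    omega
  obtain rfl | rfl | rfl : k = -1 ∨ k = 0 ∨ k = 1 := by omega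
  -- With total `2ℓ`, a value `-ℓ` would force the other three to be `ℓ`; hence the strict lower
  -- bounds.
  · exact (h.neg.hasNetBoundedShift_of_sum_eq_two_mul (by linarith) (by omega)).of_neg
  · refine h.hasNetBoundedShift_of_sum_eq_zero (by linarith) ?_
    simpa only [abs_eq (by linarith : 0 ≤ ℓ)] using hne
  · exact h.hasNetBoundedShift_of_sum_eq_two_mul (by linarith) (by omega)

/-- The exceptional net out-degrees, all of absolute value `ℓ`. -/
theorem IsDense.hasNetBoundedShift_of_abs_eq
    (h : IsDense ℓ d₁ d₂ d₃ d₄ c₁₂ c₁₃ c₁₄ r₁ r₂ r₃ r₄)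
    (ha : |r₁| = ℓ ∧ |r₂| = ℓ ∧ |r₃| = ℓ ∧ |r₄| = ℓ)
    (hc : 2 * ℓ ≤ c₁₂ ∨ 2 * ℓ ≤ c₁₃ ∨ 2 * ℓ ≤ c₁₄) :
    HasNetBoundedShift ℓ d₁ d₂ d₃ d₄ c₁₂ c₁₃ c₁₄ r₁ r₂ r₃ r₄ := by
  have hl := h.two_le
  -- Modulo `2ℓ` the values `ℓ` and `-ℓ` agree, so the sign at each vertex is free.
  have ex : ∀ r d ε : ℤ, |r| = ℓ → -d ≤ r → r ≤ d → ε = 1 ∨ ε = -1 →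
      ∃ t, r + 2 * ℓ * t = ε * ℓ ∧ ℓ ≤ d := by
    rintro r d ε hr h1 h2 hε
    rcases (abs_eq (by linarith : 0 ≤ ℓ)).1 hr with rfl | rfl <;> rcases hε with rfl | rfl
    · exact ⟨0, by ring, h2⟩
    · exact ⟨-1, by ring, h2⟩
    · exact ⟨1, by ring, by linarith⟩
    · exact ⟨0, by ring, by linarith⟩
  -- Vertex 1 gets sign `+`, as does exactly one other vertex. The cut around these two must carry
  -- `2ℓ`; the other two cuts carry `0`.
  have main : ∀ ε₂ ε₃ ε₄ : ℤ, (ε₂ = 1 ∨ ε₂ = -1) → (ε₃ = 1 ∨ ε₃ = -1) → (ε₄ = 1 ∨ ε₄ = -1) →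
      1 + ε₂ + ε₃ + ε₄ = 0 → (ε₂ = 1 → 2 * ℓ ≤ c₁₂) → (ε₃ = 1 → 2 * ℓ ≤ c₁₃) →
      (ε₄ = 1 → 2 * ℓ ≤ c₁₄) →
      HasNetBoundedShift ℓ d₁ d₂ d₃ d₄ c₁₂ c₁₃ c₁₄ r₁ r₂ r₃ r₄ := by
    intro ε₂ ε₃ ε₄ h2 h3 h4 hs k2 k3 k4
    obtain ⟨t₁, e₁, l₁⟩ := ex r₁ d₁ 1 ha.1 h.neg_deg_le.1.1 h.le_deg.1.1 (.inl rfl)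
    obtain ⟨t₂, e₂, l₂⟩ := ex r₂ d₂ ε₂ ha.2.1 h.neg_deg_le.1.2 h.le_deg.1.2 h2
    obtain ⟨t₃, e₃, l₃⟩ := ex r₃ d₃ ε₃ ha.2.2.1 h.neg_deg_le.2.1 h.le_deg.2.1 h3
    obtain ⟨t₄, e₄, l₄⟩ := ex r₄ d₄ ε₄ ha.2.2.2 h.neg_deg_le.2.2 h.le_deg.2.2 h4
    refine ⟨t₁, t₂, t₃, t₄, ?_⟩
    rw [e₁, e₂, e₃, e₄]
    have hcut := h.cut
    clear h ex
    rcases h2 with rfl | rfl <;> rcases h3 with rfl | rfl <;> rcases h4 with rfl | rfl <;>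
      simp only [IsNetBounded, abs_le] <;> omega
  rcases hc with hc | hc | hc
  · exact main 1 (-1) (-1) (by simp) (by simp) (by simp) (by norm_num) (by simp [hc]) (by norm_num)
      (by norm_num)
  · exact main (-1) 1 (-1) (by simp) (by simp) (by simp) (by norm_num) (by norm_num) (by simp [hc])
      (by norm_num)
  · exact main (-1) (-1) 1 (by simp) (by simp) (by simp) (by norm_num) (by norm_num) (by norm_num)
      (by simp [hc])
end Graph

/-! ### Orientations with prescribed out-degrees. -/

namespace Graph

/-- The condition on out-degrees `p` for the existence of an orientation of the graph on four
vertices with multiplicities `m`. -/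
structure IsOutFeasible (m₁₂ m₁₃ m₁₄ m₂₃ m₂₄ m₃₄ p₁ p₂ p₃ p₄ : ℤ) : Prop where
  sum : p₁ + p₂ + p₃ + p₄ = m₁₂ + m₁₃ + m₁₄ + m₂₃ + m₂₄ + m₃₄
  mult : (0 ≤ m₁₂ ∧ 0 ≤ m₁₃ ∧ 0 ≤ m₁₄) ∧ 0 ≤ m₂₃ ∧ 0 ≤ m₂₄ ∧ 0 ≤ m₃₄
  one : (0 ≤ p₁ ∧ 0 ≤ p₂) ∧ 0 ≤ p₃ ∧ 0 ≤ p₄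
  two : (m₁₂ ≤ p₁ + p₂ ∧ m₁₃ ≤ p₁ + p₃ ∧ m₁₄ ≤ p₁ + p₄) ∧
    m₂₃ ≤ p₂ + p₃ ∧ m₂₄ ≤ p₂ + p₄ ∧ m₃₄ ≤ p₃ + p₄
  three : (m₁₂ + m₁₃ + m₂₃ ≤ p₁ + p₂ + p₃ ∧ m₁₂ + m₁₄ + m₂₄ ≤ p₁ + p₂ + p₄) ∧
    m₁₃ + m₁₄ + m₃₄ ≤ p₁ + p₃ + p₄ ∧ m₂₃ + m₂₄ + m₃₄ ≤ p₂ + p₃ + p₄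

variable {ℓ m₁₂ m₁₃ m₁₄ m₂₃ m₂₄ m₃₄ p₁ p₂ p₃ p₄ : ℤ}

theorem IsOutFeasible.swap₁₂ (h : IsOutFeasible m₁₂ m₁₃ m₁₄ m₂₃ m₂₄ m₃₄ p₁ p₂ p₃ p₄) :
    IsOutFeasible m₁₂ m₂₃ m₂₄ m₁₃ m₁₄ m₃₄ p₂ p₁ p₃ p₄ where
  sum := by have := h.sum; omega
  mult := by have := h.mult; omega
  one := by have := h.one; omega
  two := by have := h.two; omega
  three := by have := h.three; omega

theorem IsOutFeasible.swap₂₃ (h : IsOutFeasible m₁₂ m₁₃ m₁₄ m₂₃ m₂₄ m₃₄ p₁ p₂ p₃ p₄) :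
    IsOutFeasible m₁₃ m₁₂ m₁₄ m₂₃ m₃₄ m₂₄ p₁ p₃ p₂ p₄ where
  sum := by have := h.sum; omega
  mult := by have := h.mult; omega
  one := by have := h.one; omega
  two := by have := h.two; omega
  three := by have := h.three; omega

theorem IsOutFeasible.swap₃₄ (h : IsOutFeasible m₁₂ m₁₃ m₁₄ m₂₃ m₂₄ m₃₄ p₁ p₂ p₃ p₄) :
    IsOutFeasible m₁₂ m₁₄ m₁₃ m₂₄ m₂₃ m₃₄ p₁ p₂ p₄ p₃ where
  sum := by have := h.sum; omega
  mult := by have := h.mult; omega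
  one := by have := h.one; omega
  two := by have := h.two; omega
  three := by have := h.three; omega

/-- Orienting the edges between the first two vertices. -/
theorem IsOutFeasible.exists_orient_pair
    (h : IsOutFeasible m₁₂ m₁₃ m₁₄ m₂₃ m₂₄ m₃₄ p₁ p₂ p₃ p₄) :
    ∃ y, (0 ≤ y ∧ y ≤ m₁₂) ∧
      IsOutFeasible 0 m₁₃ m₁₄ m₂₃ m₂₄ m₃₄ (p₁ - y) (p₂ - (m₁₂ - y)) p₃ p₄ := by
  obtain ⟨hs, ⟨⟨_, _, _⟩, _, _, _⟩, ⟨⟨_, _⟩, _, _⟩, ⟨⟨_, _, _⟩, _, _, _⟩, ⟨_, _⟩, _, _⟩ := h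
  -- Besides `0 ≤ y ≤ m₁₂`, sets containing 2 but not 1 bound `y` below, and those containing 1 but
  -- not 2 bound it above. Each lower bound is at most each upper bound because the number of edges
  -- inside a set is supermodular, the pair 1–2 being counted only in the union.
  obtain ⟨y, hl, hu⟩ : ∃ y : ℤ,
      ((0 ≤ y ∧ m₁₂ - p₂ ≤ y) ∧ m₁₂ + m₂₃ - (p₂ + p₃) ≤ y ∧ m₁₂ + m₂₄ - (p₂ + p₄) ≤ y ∧
        m₁₂ + m₂₃ + m₂₄ + m₃₄ - (p₂ + p₃ + p₄) ≤ y) ∧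
      ((y ≤ m₁₂ ∧ y ≤ p₁) ∧ y ≤ p₁ + p₃ - m₁₃ ∧ y ≤ p₁ + p₄ - m₁₄ ∧
        y ≤ p₁ + p₃ + p₄ - (m₁₃ + m₁₄ + m₃₄)) := by
    refine ⟨min (min m₁₂ p₁) (min (p₁ + p₃ - m₁₃) (min (p₁ + p₄ - m₁₄)
      (p₁ + p₃ + p₄ - (m₁₃ + m₁₄ + m₃₄)))), ?_, ?_⟩
    · simp only [le_min_iff]
      and_intros <;> linarith
    · clear * -
      omega
  refine ⟨y, ⟨hl.1.1, hu.1.1⟩, ?_, ?_, ?_, ?_, ?_⟩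
  · linarith
  all_goals and_intros <;> linarith

/-- Hakimi's theorem for four vertices. -/
theorem IsOutFeasible.exists_flow
    (h : IsOutFeasible m₁₂ m₁₃ m₁₄ m₂₃ m₂₄ m₃₄ p₁ p₂ p₃ p₄) :
    ∃ y₁₂ y₁₃ y₁₄ y₂₃ y₂₄ y₃₄ : ℤ,
      ((0 ≤ y₁₂ ∧ y₁₂ ≤ m₁₂) ∧ (0 ≤ y₁₃ ∧ y₁₃ ≤ m₁₃) ∧ (0 ≤ y₁₄ ∧ y₁₄ ≤ m₁₄) ∧
        (0 ≤ y₂₃ ∧ y₂₃ ≤ m₂₃) ∧ (0 ≤ y₂₄ ∧ y₂₄ ≤ m₂₄) ∧ (0 ≤ y₃₄ ∧ y₃₄ ≤ m₃₄)) ∧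
      y₁₂ + y₁₃ + y₁₄ = p₁ ∧ (m₁₂ - y₁₂) + y₂₃ + y₂₄ = p₂ ∧
      (m₁₃ - y₁₃) + (m₂₃ - y₂₃) + y₃₄ = p₃ ∧ (m₁₄ - y₁₄) + (m₂₄ - y₂₄) + (m₃₄ - y₃₄) = p₄ := by
  obtain ⟨y₁₂, b₁₂, h⟩ := h.exists_orient_pair
  obtain ⟨y₁₃, b₁₃, h⟩ := h.swap₂₃.exists_orient_pair
  obtain ⟨y₁₄, b₁₄, h⟩ := h.swap₃₄.swap₂₃.exists_orient_pair
  obtain ⟨z₃₄, b₃₄, h⟩ := h.swap₁₂.swap₂₃.exists_orient_pair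
  obtain ⟨z₂₄, b₂₄, h⟩ := h.swap₃₄.swap₂₃.exists_orient_pair
  obtain ⟨y₂₃, b₂₃, h⟩ := h.swap₁₂.swap₂₃.exists_orient_pair
  -- All multiplicities are now zero, so the remaining out-degrees are nonnegative with sum zero and
  -- vanish.
  have h1 := h.one
  have h2 := h.sum
  -- The permutations put vertex 4 first in its pairs with 3 and 2, so `z₃₄` and `z₂₄` count arcs
  -- leaving 4.
  refine ⟨y₁₂, y₁₃, y₁₄, y₂₃, m₂₄ - z₂₄, m₃₄ - z₃₄, ⟨b₁₂, b₁₃, b₁₄, b₂₃, ?_, ?_⟩, ?_⟩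
  all_goals omega
end Graph

/-! ### Flows modulo `ℓ`: the numerical criterion. -/

namespace Graph

/-- The net flows of the graph on four vertices with multiplicities `m`, of at most `m` along
each pair, represent all zero-sum vectors modulo `ℓ`. -/
def FlowsCover (ℓ m₁₂ m₁₃ m₁₄ m₂₃ m₂₄ m₃₄ : ℤ) : Prop :=
  ∀ g₁ g₂ g₃ g₄ : ℤ, ℓ ∣ g₁ + g₂ + g₃ + g₄ → ∃ y₁₂ y₁₃ y₁₄ y₂₃ y₂₄ y₃₄ : ℤ,
    ((0 ≤ y₁₂ ∧ y₁₂ ≤ m₁₂) ∧ (0 ≤ y₁₃ ∧ y₁₃ ≤ m₁₃) ∧ (0 ≤ y₁₄ ∧ y₁₄ ≤ m₁₄) ∧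
      (0 ≤ y₂₃ ∧ y₂₃ ≤ m₂₃) ∧ (0 ≤ y₂₄ ∧ y₂₄ ≤ m₂₄) ∧ (0 ≤ y₃₄ ∧ y₃₄ ≤ m₃₄)) ∧
    ℓ ∣ y₁₂ + y₁₃ + y₁₄ - g₁ ∧ ℓ ∣ y₂₃ + y₂₄ - y₁₂ - g₂ ∧
    ℓ ∣ y₃₄ - y₁₃ - y₂₃ - g₃ ∧ ℓ ∣ - y₁₄ - y₂₄ - y₃₄ - g₄

variable {ℓ m₁₂ m₁₃ m₁₄ m₂₃ m₂₄ m₃₄ : ℤ}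

theorem exists_shift_range (hl : 0 < ℓ) (x : ℤ) :
    ∃ k, -ℓ ≤ x + 2 * ℓ * k ∧ x + 2 * ℓ * k ≤ ℓ := by
  refine ⟨-((x + ℓ) / (2 * ℓ)), ?_⟩
  have h1 := Int.emod_add_mul_ediv (x + ℓ) (2 * ℓ)
  have h2 := Int.emod_nonneg (x + ℓ) (by linarith : 2 * ℓ ≠ 0)
  have h3 := Int.emod_lt_of_pos (x + ℓ) (by linarith : 0 < 2 * ℓ)
  constructor <;> linarith

/-- For a flow value `z`, twice `z` minus the signed sum of multiplicities is the net out-degree.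
The hypothesis `hex` serves only the case of four values `±ℓ`. -/
theorem hasNetBoundedShift_of_le (hl : 2 ≤ ℓ)
    (h0 : (0 ≤ m₁₂ ∧ 0 ≤ m₁₃ ∧ 0 ≤ m₁₄) ∧ 0 ≤ m₂₃ ∧ 0 ≤ m₂₄ ∧ 0 ≤ m₃₄)
    (h1 : (m₁₂ ≤ ℓ - 1 ∧ m₁₃ ≤ ℓ - 1 ∧ m₁₄ ≤ ℓ - 1) ∧
      m₂₃ ≤ ℓ - 1 ∧ m₂₄ ≤ ℓ - 1 ∧ m₃₄ ≤ ℓ - 1)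
    (hd : (ℓ - 1 ≤ m₁₂ + m₁₃ + m₁₄ ∧ ℓ - 1 ≤ m₁₂ + m₂₃ + m₂₄) ∧
      ℓ - 1 ≤ m₁₃ + m₂₃ + m₃₄ ∧ ℓ - 1 ≤ m₁₄ + m₂₄ + m₃₄)
    (he : 3 * ℓ - 3 ≤ m₁₂ + m₁₃ + m₁₄ + m₂₃ + m₂₄ + m₃₄)
    (hex : (2 ∣ m₁₂ + m₁₃ + m₁₄ - ℓ ∧ 2 ∣ m₁₂ + m₂₃ + m₂₄ - ℓ) →
      (2 ∣ m₁₃ + m₂₃ + m₃₄ - ℓ ∧ 2 ∣ m₁₄ + m₂₄ + m₃₄ - ℓ) →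
      2 * ℓ ≤ m₁₃ + m₁₄ + m₂₃ + m₂₄ ∨ 2 * ℓ ≤ m₁₂ + m₁₄ + m₂₃ + m₃₄ ∨
        2 * ℓ ≤ m₁₂ + m₁₃ + m₂₄ + m₃₄)
    {z₁ z₂ z₃ z₄ : ℤ} (hs : ℓ ∣ z₁ + z₂ + z₃ + z₄)
    (hr : (-ℓ ≤ 2 * z₁ - (m₁₂ + m₁₃ + m₁₄) ∧ -ℓ ≤ 2 * z₂ - (m₂₃ + m₂₄ - m₁₂) ∧
      -ℓ ≤ 2 * z₃ - (m₃₄ - m₁₃ - m₂₃) ∧ -ℓ ≤ 2 * z₄ - (- m₁₄ - m₂₄ - m₃₄)) ∧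
      (2 * z₁ - (m₁₂ + m₁₃ + m₁₄) ≤ ℓ ∧ 2 * z₂ - (m₂₃ + m₂₄ - m₁₂) ≤ ℓ ∧
      2 * z₃ - (m₃₄ - m₁₃ - m₂₃) ≤ ℓ ∧ 2 * z₄ - (- m₁₄ - m₂₄ - m₃₄) ≤ ℓ)) :
    HasNetBoundedShift ℓ (m₁₂ + m₁₃ + m₁₄) (m₁₂ + m₂₃ + m₂₄) (m₁₃ + m₂₃ + m₃₄)
      (m₁₄ + m₂₄ + m₃₄) (m₁₃ + m₁₄ + m₂₃ + m₂₄) (m₁₂ + m₁₄ + m₂₃ + m₃₄)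
      (m₁₂ + m₁₃ + m₂₄ + m₃₄) (2 * z₁ - (m₁₂ + m₁₃ + m₁₄)) (2 * z₂ - (m₂₃ + m₂₄ - m₁₂))
      (2 * z₃ - (m₃₄ - m₁₃ - m₂₃)) (2 * z₄ - (- m₁₄ - m₂₄ - m₃₄)) := by
  have h : IsDense ℓ (m₁₂ + m₁₃ + m₁₄) (m₁₂ + m₂₃ + m₂₄) (m₁₃ + m₂₃ + m₃₄) (m₁₄ + m₂₄ + m₃₄)
      (m₁₃ + m₁₄ + m₂₃ + m₂₄) (m₁₂ + m₁₄ + m₂₃ + m₃₄) (m₁₂ + m₁₃ + m₂₄ + m₃₄)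
      (2 * z₁ - (m₁₂ + m₁₃ + m₁₄)) (2 * z₂ - (m₂₃ + m₂₄ - m₁₂))
      (2 * z₃ - (m₃₄ - m₁₃ - m₂₃)) (2 * z₄ - (- m₁₄ - m₂₄ - m₃₄)) := by
    -- With `e` edges, `c₁₂ = e - m₁₂ - m₃₄`, `c₁₂ + c₁₃ = e + m₁₄ + m₂₃`, `d₁ + d₂ + c₁₂ = 2 (e -
    -- m₃₄)` and `d₁ + d₂ + c₁₃ + c₁₄ = 2 (e + m₁₂)`; the bounds follow from `e ≥ 3ℓ - 3` and `0 ≤ m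
    -- ≤ ℓ - 1`.
    constructor
    · exact hl
    · tauto
    · and_intros <;> linarith
    · ring
    · linarith
    · and_intros <;> linarith
    · and_intros <;> linarith
    · and_intros <;> linarith
    · clear * -
      omega
    · exact hr
  by_cases ha : |2 * z₁ - (m₁₂ + m₁₃ + m₁₄)| = ℓ ∧ |2 * z₂ - (m₂₃ + m₂₄ - m₁₂)| = ℓ ∧
      |2 * z₃ - (m₃₄ - m₁₃ - m₂₃)| = ℓ ∧ |2 * z₄ - (- m₁₄ - m₂₄ - m₃₄)| = ℓ
  · refine h.hasNetBoundedShift_of_abs_eq ha ?_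
    have even_sub : ∀ r d : ℤ, |r| = ℓ → 2 ∣ d - r → 2 ∣ d - ℓ := by
      clear * - hl
      intro r d hr
      rcases (abs_eq (by linarith : 0 ≤ ℓ)).1 hr with rfl | rfl <;> omega
    have hp := h.parity.1
    exact hex ⟨even_sub _ _ ha.1 hp.1, even_sub _ _ ha.2.1 hp.2.1⟩
      ⟨even_sub _ _ ha.2.2.1 hp.2.2.1, even_sub _ _ ha.2.2.2 hp.2.2.2⟩
  · refine h.hasNetBoundedShift ?_ ha
    obtain ⟨s, hs⟩ := hs
    exact ⟨s, by linear_combination 2 * hs⟩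

theorem exists_flow_of_hasNetBoundedShift {z₁ z₂ z₃ z₄ : ℤ}
    (h0 : (0 ≤ m₁₂ ∧ 0 ≤ m₁₃ ∧ 0 ≤ m₁₄) ∧ 0 ≤ m₂₃ ∧ 0 ≤ m₂₄ ∧ 0 ≤ m₃₄)
    (h : HasNetBoundedShift ℓ (m₁₂ + m₁₃ + m₁₄) (m₁₂ + m₂₃ + m₂₄) (m₁₃ + m₂₃ + m₃₄)
      (m₁₄ + m₂₄ + m₃₄) (m₁₃ + m₁₄ + m₂₃ + m₂₄) (m₁₂ + m₁₄ + m₂₃ + m₃₄)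
      (m₁₂ + m₁₃ + m₂₄ + m₃₄)
      (2 * z₁ - (m₁₂ + m₁₃ + m₁₄)) (2 * z₂ - (m₂₃ + m₂₄ - m₁₂))
      (2 * z₃ - (m₃₄ - m₁₃ - m₂₃)) (2 * z₄ - (- m₁₄ - m₂₄ - m₃₄))) :
    ∃ y₁₂ y₁₃ y₁₄ y₂₃ y₂₄ y₃₄ : ℤ,
    ((0 ≤ y₁₂ ∧ y₁₂ ≤ m₁₂) ∧ (0 ≤ y₁₃ ∧ y₁₃ ≤ m₁₃) ∧ (0 ≤ y₁₄ ∧ y₁₄ ≤ m₁₄) ∧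
      (0 ≤ y₂₃ ∧ y₂₃ ≤ m₂₃) ∧ (0 ≤ y₂₄ ∧ y₂₄ ≤ m₂₄) ∧ (0 ≤ y₃₄ ∧ y₃₄ ≤ m₃₄)) ∧
    ℓ ∣ y₁₂ + y₁₃ + y₁₄ - z₁ ∧ ℓ ∣ y₂₃ + y₂₄ - y₁₂ - z₂ ∧
    ℓ ∣ y₃₄ - y₁₃ - y₂₃ - z₃ ∧ ℓ ∣ - y₁₄ - y₂₄ - y₃₄ - z₄ := by
  obtain ⟨t₁, t₂, t₃, t₄, hs, hdeg, hcut⟩ := h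
  simp only [abs_le] at hdeg hcut
  -- Adding the edges to lower vertices turns a flow value into an out-degree `p`. As `r = 2p - d`,
  -- the bounds on `r` become Hakimi's inequalities, those for triples coming from the complementary
  -- vertex.
  have hf : IsOutFeasible m₁₂ m₁₃ m₁₄ m₂₃ m₂₄ m₃₄ (z₁ + ℓ * t₁) (z₂ + ℓ * t₂ + m₁₂)
      (z₃ + ℓ * t₃ + m₁₃ + m₂₃) (z₄ + ℓ * t₄ + m₁₄ + m₂₄ + m₃₄) := by
    constructor
    · linarith
    · exact h0
    all_goals and_intros <;> linarith
  obtain ⟨y₁₂, y₁₃, y₁₄, y₂₃, y₂₄, y₃₄, hy, e₁, e₂, e₃, e₄⟩ := hf.exists_flow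
  exact ⟨y₁₂, y₁₃, y₁₄, y₂₃, y₂₄, y₃₄, hy, ⟨t₁, by linarith⟩, ⟨t₂, by linarith⟩,
    ⟨t₃, by linarith⟩, ⟨t₄, by linarith⟩⟩

theorem flowsCover_of_le (hl : 2 ≤ ℓ)
    (h0 : (0 ≤ m₁₂ ∧ 0 ≤ m₁₃ ∧ 0 ≤ m₁₄) ∧ 0 ≤ m₂₃ ∧ 0 ≤ m₂₄ ∧ 0 ≤ m₃₄)
    (h1 : (m₁₂ ≤ ℓ - 1 ∧ m₁₃ ≤ ℓ - 1 ∧ m₁₄ ≤ ℓ - 1) ∧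
      m₂₃ ≤ ℓ - 1 ∧ m₂₄ ≤ ℓ - 1 ∧ m₃₄ ≤ ℓ - 1)
    (hd : (ℓ - 1 ≤ m₁₂ + m₁₃ + m₁₄ ∧ ℓ - 1 ≤ m₁₂ + m₂₃ + m₂₄) ∧
      ℓ - 1 ≤ m₁₃ + m₂₃ + m₃₄ ∧ ℓ - 1 ≤ m₁₄ + m₂₄ + m₃₄)
    (he : 3 * ℓ - 3 ≤ m₁₂ + m₁₃ + m₁₄ + m₂₃ + m₂₄ + m₃₄)
    (hex : (2 ∣ m₁₂ + m₁₃ + m₁₄ - ℓ ∧ 2 ∣ m₁₂ + m₂₃ + m₂₄ - ℓ) →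
      (2 ∣ m₁₃ + m₂₃ + m₃₄ - ℓ ∧ 2 ∣ m₁₄ + m₂₄ + m₃₄ - ℓ) →
      2 * ℓ ≤ m₁₃ + m₁₄ + m₂₃ + m₂₄ ∨ 2 * ℓ ≤ m₁₂ + m₁₄ + m₂₃ + m₃₄ ∨
        2 * ℓ ≤ m₁₂ + m₁₃ + m₂₄ + m₃₄) :
    FlowsCover ℓ m₁₂ m₁₃ m₁₄ m₂₃ m₂₄ m₃₄ := by
  intro g₁ g₂ g₃ g₄ hs
  have range : ∀ g c : ℤ, ∃ k, -ℓ ≤ 2 * (g + ℓ * k) - c ∧ 2 * (g + ℓ * k) - c ≤ ℓ := by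
    intro g c
    obtain ⟨k, hk⟩ := exists_shift_range (by linarith : 0 < ℓ) (2 * g - c)
    exact ⟨k, by linarith, by linarith⟩
  obtain ⟨k₁, a₁, b₁⟩ := range g₁ (m₁₂ + m₁₃ + m₁₄)
  obtain ⟨k₂, a₂, b₂⟩ := range g₂ (m₂₃ + m₂₄ - m₁₂)
  obtain ⟨k₃, a₃, b₃⟩ := range g₃ (m₃₄ - m₁₃ - m₂₃)
  obtain ⟨k₄, a₄, b₄⟩ := range g₄ (- m₁₄ - m₂₄ - m₃₄)
  have hs' : ℓ ∣ g₁ + ℓ * k₁ + (g₂ + ℓ * k₂) + (g₃ + ℓ * k₃) + (g₄ + ℓ * k₄) := by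
    obtain ⟨s, hs⟩ := hs
    exact ⟨s + k₁ + k₂ + k₃ + k₄, by linear_combination hs⟩
  obtain ⟨y₁₂, y₁₃, y₁₄, y₂₃, y₂₄, y₃₄, hy, ⟨q₁, e₁⟩, ⟨q₂, e₂⟩, ⟨q₃, e₃⟩, q₄, e₄⟩ :=
    exists_flow_of_hasNetBoundedShift h0 <| hasNetBoundedShift_of_le hl h0 h1 hd he hex hs'
      ⟨⟨a₁, a₂, a₃, a₄⟩, b₁, b₂, b₃, b₄⟩
  exact ⟨y₁₂, y₁₃, y₁₄, y₂₃, y₂₄, y₃₄, hy, ⟨q₁ + k₁, by linarith⟩, ⟨q₂ + k₂, by linarith⟩,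
    ⟨q₃ + k₃, by linarith⟩, ⟨q₄ + k₄, by linarith⟩⟩

/-- The interval has `A + B + 1` integers; if these are fewer than `ℓ`, the residue of `B + 1` is
missed. -/
theorem le_add_of_forall_exists_dvd_sub {A B : ℤ}
    (h : ∀ g, ∃ y, -A ≤ y ∧ y ≤ B ∧ ℓ ∣ y - g) : ℓ - 1 ≤ A + B := by
  obtain ⟨y, h1, h2, hy⟩ := h (B + 1)
  by_contra! hlt
  have := Int.le_of_dvd (by linarith) (dvd_sub_comm.1 hy)
  linarith

theorem FlowsCover.le_deg (h : FlowsCover ℓ m₁₂ m₁₃ m₁₄ m₂₃ m₂₄ m₃₄) :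
    (ℓ - 1 ≤ m₁₂ + m₁₃ + m₁₄ ∧ ℓ - 1 ≤ m₁₂ + m₂₃ + m₂₄) ∧
      ℓ - 1 ≤ m₁₃ + m₂₃ + m₃₄ ∧ ℓ - 1 ≤ m₁₄ + m₂₄ + m₃₄ := by
  refine ⟨⟨?_, ?_⟩, ?_, ?_⟩
  · rw [show m₁₂ + m₁₃ + m₁₄ = 0 + (m₁₂ + m₁₃ + m₁₄) by ring]
    refine le_add_of_forall_exists_dvd_sub fun g ↦ ?_
    obtain ⟨_, _, _, _, _, _, _, h1, -⟩ := h g (-g) 0 0 (by simp)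
    exact ⟨_, by linarith, by linarith, h1⟩
  · rw [show m₁₂ + m₂₃ + m₂₄ = m₁₂ + (m₂₃ + m₂₄) by ring]
    refine le_add_of_forall_exists_dvd_sub fun g ↦ ?_
    obtain ⟨_, _, _, _, _, _, _, -, h1, -⟩ := h 0 g (-g) 0 (by simp)
    exact ⟨_, by linarith, by linarith, h1⟩
  · refine le_add_of_forall_exists_dvd_sub fun g ↦ ?_
    obtain ⟨_, _, _, _, _, _, _, -, -, h1, -⟩ := h 0 0 g (-g) (by simp)
    exact ⟨_, by linarith, by linarith, h1⟩
  · rw [show m₁₄ + m₂₄ + m₃₄ = m₁₄ + m₂₄ + m₃₄ + 0 by ring]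
    refine le_add_of_forall_exists_dvd_sub fun g ↦ ?_
    obtain ⟨_, _, _, _, _, _, _, -, -, -, h1⟩ := h 0 0 (-g) g (by simp)
    exact ⟨_, by linarith, by linarith, h1⟩

theorem FlowsCover.le_numEdges (h : FlowsCover ℓ m₁₂ m₁₃ m₁₄ m₂₃ m₂₄ m₃₄) :
    3 * ℓ - 3 ≤ m₁₂ + m₁₃ + m₁₄ + m₂₃ + m₂₄ + m₃₄ := by
  -- The demands say that vertices 2, 3, 4 have out-degree `-1` modulo `ℓ`, hence at least `ℓ - 1`
  -- each.
  obtain ⟨y₁₂, y₁₃, y₁₄, y₂₃, y₂₄, y₃₄, hy, -, h2, h3, h4⟩ :=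
    h (3 + m₁₂ + m₁₃ + m₂₃ + m₁₄ + m₂₄ + m₃₄) (-1 - m₁₂) (-1 - m₁₃ - m₂₃)
      (-1 - m₁₄ - m₂₄ - m₃₄) ⟨0, by ring⟩
  have := Int.le_of_dvd (by linarith) h2
  have := Int.le_of_dvd (by linarith) h3
  have := Int.le_of_dvd (by linarith) h4
  linarith

/-- Demand net out-degree `ℓ` everywhere, which the parity of the degrees allows. Every pair then
has net out-degree divisible by `2ℓ` but at most `2ℓ - 2` in absolute value, hence zero. So each
vertex has net out-degree zero, which is not `ℓ` modulo `2ℓ`. -/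
theorem FlowsCover.cut_ne (h : FlowsCover ℓ m₁₂ m₁₃ m₁₄ m₂₃ m₂₄ m₃₄) (hl : 2 ≤ ℓ)
    (hd : (2 ∣ m₁₂ + m₁₃ + m₁₄ - ℓ ∧ 2 ∣ m₁₂ + m₂₃ + m₂₄ - ℓ) ∧
      2 ∣ m₁₃ + m₂₃ + m₃₄ - ℓ ∧ 2 ∣ m₁₄ + m₂₄ + m₃₄ - ℓ) :
    ¬ (m₁₃ + m₁₄ + m₂₃ + m₂₄ = 2 * ℓ - 2 ∧ m₁₂ + m₁₄ + m₂₃ + m₃₄ = 2 * ℓ - 2 ∧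
        m₁₂ + m₁₃ + m₂₄ + m₃₄ = 2 * ℓ - 2) := by
  rintro ⟨k₁₂, k₁₃, k₁₄⟩
  obtain ⟨g₁, e₁⟩ : ∃ g, 2 * g = ℓ + (m₁₂ + m₁₃ + m₁₄) := ⟨(ℓ + (m₁₂ + m₁₃ + m₁₄)) / 2, by omega⟩
  obtain ⟨g₂, e₂⟩ : ∃ g, 2 * g = ℓ + (m₂₃ + m₂₄ - m₁₂) := ⟨(ℓ + (m₂₃ + m₂₄ - m₁₂)) / 2, by omega⟩
  obtain ⟨g₃, e₃⟩ : ∃ g, 2 * g = ℓ + (m₃₄ - m₁₃ - m₂₃) := ⟨(ℓ + (m₃₄ - m₁₃ - m₂₃)) / 2, by omega⟩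
  obtain ⟨g₄, e₄⟩ : ∃ g, 2 * g = ℓ + (- m₁₄ - m₂₄ - m₃₄) :=
    ⟨(ℓ + (- m₁₄ - m₂₄ - m₃₄)) / 2, by omega⟩
  obtain ⟨y₁₂, y₁₃, y₁₄, y₂₃, y₂₄, y₃₄, hy, ⟨q₁, h1⟩, ⟨q₂, h2⟩, ⟨q₃, h3⟩, -⟩ :=
    h g₁ g₂ g₃ g₄ ⟨2, by linarith⟩
  have eq_zero : ∀ q x : ℤ, x = 2 * ℓ * q → -(2 * ℓ - 2) ≤ x → x ≤ 2 * ℓ - 2 → x = 0 := by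
    intro q x hx h1 h2
    refine Int.eq_zero_of_abs_lt_dvd (m := 2 * ℓ) ⟨q, hx⟩ ?_
    rw [abs_lt]
    constructor <;> linarith
  have z₁₂ := eq_zero (q₁ + q₂ + 1) ((2 * (y₁₂ + y₁₃ + y₁₄) - (m₁₂ + m₁₃ + m₁₄)) +
    (2 * (y₂₃ + y₂₄ - y₁₂) - (m₂₃ + m₂₄ - m₁₂))) (by linarith) (by linarith) (by linarith)
  have z₁₃ := eq_zero (q₁ + q₃ + 1) ((2 * (y₁₂ + y₁₃ + y₁₄) - (m₁₂ + m₁₃ + m₁₄)) +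
    (2 * (y₃₄ - y₁₃ - y₂₃) - (m₃₄ - m₁₃ - m₂₃))) (by linarith) (by linarith) (by linarith)
  have z₂₃ := eq_zero (q₂ + q₃ + 1) ((2 * (y₂₃ + y₂₄ - y₁₂) - (m₂₃ + m₂₄ - m₁₂)) +
    (2 * (y₃₄ - y₁₃ - y₂₃) - (m₃₄ - m₁₃ - m₂₃))) (by linarith) (by linarith) (by linarith)
  have : ℓ * (2 * q₁ + 1) = 0 := by linarith
  rcases mul_eq_zero.1 this with h | h <;> omega

theorem flowsCover_iff (hl : 2 ≤ ℓ)
    (h0 : (0 ≤ m₁₂ ∧ 0 ≤ m₁₃ ∧ 0 ≤ m₁₄) ∧ 0 ≤ m₂₃ ∧ 0 ≤ m₂₄ ∧ 0 ≤ m₃₄)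
    (h1 : (m₁₂ ≤ ℓ - 1 ∧ m₁₃ ≤ ℓ - 1 ∧ m₁₄ ≤ ℓ - 1) ∧
      m₂₃ ≤ ℓ - 1 ∧ m₂₄ ≤ ℓ - 1 ∧ m₃₄ ≤ ℓ - 1) :
    FlowsCover ℓ m₁₂ m₁₃ m₁₄ m₂₃ m₂₄ m₃₄ ↔
      ((ℓ - 1 ≤ m₁₂ + m₁₃ + m₁₄ ∧ ℓ - 1 ≤ m₁₂ + m₂₃ + m₂₄) ∧
        ℓ - 1 ≤ m₁₃ + m₂₃ + m₃₄ ∧ ℓ - 1 ≤ m₁₄ + m₂₄ + m₃₄) ∧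
      3 * ℓ - 3 ≤ m₁₂ + m₁₃ + m₁₄ + m₂₃ + m₂₄ + m₃₄ ∧
      ((((m₁₂ = ℓ - 1 ∨ m₁₃ = ℓ - 1 ∨ m₁₄ = ℓ - 1) ∨ m₂₃ = ℓ - 1 ∨ m₂₄ = ℓ - 1 ∨ m₃₄ = ℓ - 1) ∨
          3 * ℓ - 2 ≤ m₁₂ + m₁₃ + m₁₄ + m₂₃ + m₂₄ + m₃₄) ∨
        ¬ (m₁₃ + m₁₄ + m₂₃ + m₂₄ = 2 * ℓ - 2 ∧ m₁₂ + m₁₄ + m₂₃ + m₃₄ = 2 * ℓ - 2 ∧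
          m₁₂ + m₁₃ + m₂₄ + m₃₄ = 2 * ℓ - 2) ∨
        ¬ ((2 ∣ m₁₂ + m₁₃ + m₁₄ - ℓ ∧ 2 ∣ m₁₂ + m₂₃ + m₂₄ - ℓ) ∧
          2 ∣ m₁₃ + m₂₃ + m₃₄ - ℓ ∧ 2 ∣ m₁₄ + m₂₄ + m₃₄ - ℓ)) := by
  constructor
  · intro h
    refine ⟨h.le_deg, h.le_numEdges, ?_⟩
    by_cases hd : (2 ∣ m₁₂ + m₁₃ + m₁₄ - ℓ ∧ 2 ∣ m₁₂ + m₂₃ + m₂₄ - ℓ) ∧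
      2 ∣ m₁₃ + m₂₃ + m₃₄ - ℓ ∧ 2 ∣ m₁₄ + m₂₄ + m₃₄ - ℓ
    · exact .inr (.inl (h.cut_ne hl hd))
    · exact .inr (.inr hd)
  · rintro ⟨hd, he, hex⟩
    refine flowsCover_of_le hl h0 h1 hd he fun p q ↦ ?_
    by_contra! hc
    -- The cuts are even, and their sum is twice the number of edges, at least `6ℓ - 6`; so all
    -- three equal `2ℓ - 2`.
    have c₁₂ : m₁₃ + m₁₄ + m₂₃ + m₂₄ ≤ 2 * ℓ - 2 := by clear * - p hc; omega
    have c₁₃ : m₁₂ + m₁₄ + m₂₃ + m₃₄ ≤ 2 * ℓ - 2 := by clear * - p q hc; omega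
    have c₁₄ : m₁₂ + m₁₃ + m₂₄ + m₃₄ ≤ 2 * ℓ - 2 := by clear * - p q hc; omega
    have e₁₂ : m₁₃ + m₁₄ + m₂₃ + m₂₄ = 2 * ℓ - 2 := by linarith
    have e₁₃ : m₁₂ + m₁₄ + m₂₃ + m₃₄ = 2 * ℓ - 2 := by linarith
    have e₁₄ : m₁₂ + m₁₃ + m₂₄ + m₃₄ = 2 * ℓ - 2 := by linarith
    clear h0 h1 hc c₁₂ c₁₃ c₁₄
    -- If a pair has multiplicity `ℓ - 1`, the opposite pair has multiplicity `0`; its ends have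
    -- degree sum `2ℓ - 2`, hence degree `ℓ - 1` each, of the wrong parity.
    rcases hex with (((h | h | h) | h | h | h) | h) | h | h
    all_goals omega

theorem exists_le_min_dvd_sub {y m : ℤ} (hl : 1 ≤ ℓ) (h0 : 0 ≤ y) (h1 : y ≤ m) :
    ∃ z, (0 ≤ z ∧ z ≤ min m (ℓ - 1)) ∧ ∃ q, y = z + ℓ * q := by
  refine ⟨y % ℓ, ⟨Int.emod_nonneg _ (by linarith), le_min ?_ ?_⟩, y / ℓ,
    (Int.emod_add_mul_ediv y ℓ).symm⟩
  · have := mul_nonneg (by linarith : 0 ≤ ℓ) (Int.ediv_nonneg h0 (by linarith : 0 ≤ ℓ))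
    linarith [Int.emod_add_mul_ediv y ℓ]
  · have := Int.emod_lt_of_pos y (by linarith : 0 < ℓ)
    linarith

/-- Only the multiplicities up to `ℓ - 1` matter. -/
theorem flowsCover_min_iff (hl : 1 ≤ ℓ) :
    FlowsCover ℓ (min m₁₂ (ℓ - 1)) (min m₁₃ (ℓ - 1)) (min m₁₄ (ℓ - 1)) (min m₂₃ (ℓ - 1))
      (min m₂₄ (ℓ - 1)) (min m₃₄ (ℓ - 1)) ↔ FlowsCover ℓ m₁₂ m₁₃ m₁₄ m₂₃ m₂₄ m₃₄ := by
  constructor <;> intro h g₁ g₂ g₃ g₄ hg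
  · obtain ⟨y₁₂, y₁₃, y₁₄, y₂₃, y₂₄, y₃₄, hy, h⟩ := h g₁ g₂ g₃ g₄ hg
    simp only [le_min_iff] at hy
    exact ⟨y₁₂, y₁₃, y₁₄, y₂₃, y₂₄, y₃₄, by tauto, h⟩
  · obtain ⟨y₁₂, y₁₃, y₁₄, y₂₃, y₂₄, y₃₄, ⟨b₁₂, b₁₃, b₁₄, b₂₃, b₂₄, b₃₄⟩, ⟨k₁, e₁⟩, ⟨k₂, e₂⟩, ⟨k₃, e₃⟩,
      k₄, e₄⟩ := h g₁ g₂ g₃ g₄ hg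
    obtain ⟨z₁₂, c₁₂, q₁₂, rfl⟩ := exists_le_min_dvd_sub hl b₁₂.1 b₁₂.2
    obtain ⟨z₁₃, c₁₃, q₁₃, rfl⟩ := exists_le_min_dvd_sub hl b₁₃.1 b₁₃.2
    obtain ⟨z₁₄, c₁₄, q₁₄, rfl⟩ := exists_le_min_dvd_sub hl b₁₄.1 b₁₄.2
    obtain ⟨z₂₃, c₂₃, q₂₃, rfl⟩ := exists_le_min_dvd_sub hl b₂₃.1 b₂₃.2
    obtain ⟨z₂₄, c₂₄, q₂₄, rfl⟩ := exists_le_min_dvd_sub hl b₂₄.1 b₂₄.2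
    obtain ⟨z₃₄, c₃₄, q₃₄, rfl⟩ := exists_le_min_dvd_sub hl b₃₄.1 b₃₄.2
    refine ⟨z₁₂, z₁₃, z₁₄, z₂₃, z₂₄, z₃₄, ⟨c₁₂, c₁₃, c₁₄, c₂₃, c₂₄, c₃₄⟩,
      ⟨k₁ - (q₁₂ + q₁₃ + q₁₄), by linarith⟩, ⟨k₂ - (q₂₃ + q₂₄ - q₁₂), by linarith⟩,
      ⟨k₃ - (q₃₄ - q₁₃ - q₂₃), by linarith⟩, ⟨k₄ + q₁₄ + q₂₄ + q₃₄, by linarith⟩⟩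
end Graph

/-! ### Counting edges and arcs on four vertices. -/

namespace Graph
variable {α β : Type*} {G : Graph α β} {v : Fin 4 → α}

theorem pairMultiplicity_eq_ncard (x y : α) :
    G.pairMultiplicity x y = {e | G.IsLink e x y}.ncard := by
  simp [pairMultiplicity, edgesBetween]

theorem pairMultiplicity_comm (x y : α) : G.pairMultiplicity x y = G.pairMultiplicity y x := by
  simp only [pairMultiplicity_eq_ncard, G.isLink_comm (x := x)]

theorem pairMultiplicity_self [G.Loopless] (x : α) : G.pairMultiplicity x x = 0 := by
  simp [pairMultiplicity_eq_ncard]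

theorem ncard_eq_sum_of_iUnion {γ ι : Type*} [Fintype ι] {s : Set γ} {f : ι → Set γ}
    (hs : s.Finite) (h : s = ⋃ i, f i) (hd : Pairwise (Function.onFun Disjoint f)) :
    s.ncard = ∑ i, (f i).ncard := by
  subst h
  rw [Set.ncard_iUnion_of_finite (fun i ↦ hs.subset (Set.subset_iUnion f i)) hd,
    finsum_eq_sum_of_fintype]

/-- Asymmetry of `P` keeps an edge from being counted from both of its ends. -/
theorem ncard_setOf_isLink (hv : Function.Injective v) (hE : G.edgeSet.Finite)
    (P : Fin 4 → Fin 4 → Prop) [DecidableRel P] (hP : ∀ i j, P i j → ¬ P j i) :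
    {e | ∃ i j, P i j ∧ G.IsLink e (v i) (v j)}.ncard =
      ∑ i, ∑ j, if P i j then G.pairMultiplicity (v i) (v j) else 0 := by
  rw [ncard_eq_sum_of_iUnion (ι := Fin 4 × Fin 4)
    (f := fun p ↦ {e | P p.1 p.2 ∧ G.IsLink e (v p.1) (v p.2)}), Fintype.sum_prod_type]
  · refine Finset.sum_congr rfl fun i _ ↦ Finset.sum_congr rfl fun j _ ↦ ?_
    split_ifs with h <;> simp [h, pairMultiplicity_eq_ncard]
  · exact hE.subset fun e ⟨_, _, _, h⟩ ↦ h.edge_mem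
  · ext e
    simp
  · rintro ⟨i, j⟩ ⟨k, l⟩ hne
    refine Set.disjoint_left.2 ?_
    rintro e ⟨h1, h2⟩ ⟨h3, h4⟩
    rcases h2.eq_and_eq_or_eq_and_eq h4 with ⟨a, b⟩ | ⟨a, b⟩ <;> rw [hv.eq_iff] at a b <;>
      subst a b
    · exact hne rfl
    · exact hP _ _ h1 h3

theorem exists_isLink_of_range (hV : Set.range v = G.vertexSet) {e : β} (he : e ∈ G.edgeSet) :
    ∃ i j, G.IsLink e (v i) (v j) := by
  obtain ⟨x, y, h⟩ := G.exists_isLink_of_mem_edgeSet he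
  obtain ⟨i, rfl⟩ := hV.symm ▸ h.left_mem
  obtain ⟨j, rfl⟩ := hV.symm ▸ h.right_mem
  exact ⟨i, j, h⟩

theorem exists_isLink_lt [hl : G.Loopless] (hV : Set.range v = G.vertexSet) {e : β}
    (he : e ∈ G.edgeSet) : ∃ i j, i < j ∧ G.IsLink e (v i) (v j) := by
  obtain ⟨i, j, h⟩ := exists_isLink_of_range hV he
  rcases lt_trichotomy i j with hij | rfl | hij
  · exact ⟨i, j, hij, h⟩
  · exact absurd rfl h.ne
  · exact ⟨j, i, hij, h.symm⟩

theorem numEdges_eq_sum [G.Loopless] (hv : Function.Injective v)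
    (hV : Set.range v = G.vertexSet) (hE : G.edgeSet.Finite) :
    G.numEdges = ∑ i, ∑ j, if i < j then G.pairMultiplicity (v i) (v j) else 0 := by
  rw [← ncard_setOf_isLink hv hE (· < ·) fun _ _ ↦ lt_asymm, numEdges]
  congr 1
  ext e
  exact ⟨exists_isLink_lt hV, fun ⟨_, _, _, h⟩ ↦ h.edge_mem⟩

theorem vertexDegree_eq_sum [G.Loopless] (hv : Function.Injective v)
    (hV : Set.range v = G.vertexSet) (hE : G.edgeSet.Finite) (i : Fin 4) :
    G.vertexDegree (v i) = ∑ j, G.pairMultiplicity (v i) (v j) := by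
  have h := ncard_setOf_isLink hv hE (fun k l ↦ k = i ∧ l ≠ i) (by tauto)
  have h1 : G.loopSet (v i) = ∅ := by
    ext e
    simp
  have h2 : G.incidenceSet (v i) = {e | ∃ k l, (k = i ∧ l ≠ i) ∧ G.IsLink e (v k) (v l)} := by
    ext e
    constructor
    · rintro ⟨y, hy⟩
      obtain ⟨j, rfl⟩ := hV.symm ▸ hy.right_mem
      exact ⟨i, j, ⟨rfl, fun h ↦ hy.ne (h ▸ rfl)⟩, hy⟩
    · rintro ⟨_, l, ⟨rfl, -⟩, hl⟩
      exact hl.inc_left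
  rw [vertexDegree, h1, h2, h, Set.ncard_empty, add_zero, Finset.sum_eq_single i]
  · refine Finset.sum_congr rfl fun j _ ↦ ?_
    by_cases hj : j = i <;> simp [hj, pairMultiplicity_self]
  · intro k _ hk
    simp [hk]
  · simp

theorem setDegree_image_eq_sum (hv : Function.Injective v)
    (hV : Set.range v = G.vertexSet) (hE : G.edgeSet.Finite) (T : Finset (Fin 4)) :
    G.setDegree (v '' T) =
      ∑ i, ∑ j, if i ∈ T ∧ j ∉ T then G.pairMultiplicity (v i) (v j) else 0 := by
  rw [← ncard_setOf_isLink hv hE (fun i j ↦ i ∈ T ∧ j ∉ T) (by tauto), setDegree]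
  congr 1
  ext e
  constructor
  · rintro ⟨_, ⟨i, hi, rfl⟩, y, ⟨hy, hy'⟩, h⟩
    obtain ⟨j, rfl⟩ := hV.symm ▸ hy
    exact ⟨i, j, ⟨hi, fun hj ↦ hy' ⟨j, hj, rfl⟩⟩, h⟩
  · rintro ⟨i, j, ⟨hi, hj⟩, h⟩
    refine ⟨v i, ⟨i, hi, rfl⟩, v j, ⟨h.right_mem, ?_⟩, h⟩
    rintro ⟨k, hk, hkj⟩
    exact hj (hv hkj ▸ hk)

/-- The number of arcs from `x` to `y`. -/
noncomputable def Orientation.arcCount (D : G.Orientation) (x y : α) : ℕ :=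
  {e | D.tail e = x ∧ D.head e = y}.ncard

theorem Orientation.arcCount_add_arcCount (hE : G.edgeSet.Finite) (D : G.Orientation) {x y : α}
    (hxy : x ≠ y) : D.arcCount x y + D.arcCount y x = G.pairMultiplicity x y := by
  have := hE.to_subtype
  rw [arcCount, arcCount, ← Set.ncard_union_eq, pairMultiplicity_eq_ncard,
    ← Set.ncard_image_of_injective _ Subtype.val_injective]
  · congr 1
    ext e
    constructor
    · rintro ⟨e, ⟨rfl, rfl⟩ | ⟨rfl, rfl⟩, rfl⟩
      · exact D.isLink e
      · exact (D.isLink e).symm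
    · intro h
      refine ⟨⟨e, h.edge_mem⟩, ?_, rfl⟩
      exact ((D.isLink ⟨e, h.edge_mem⟩).eq_and_eq_or_eq_and_eq h).imp id id
  · refine Set.disjoint_left.2 ?_
    rintro e ⟨h1, -⟩ ⟨h2, -⟩
    exact hxy (h1.symm.trans h2)

theorem Orientation.arcCount_self [G.Loopless] (D : G.Orientation) (x : α) :
    D.arcCount x x = 0 := by
  refine (congrArg Set.ncard (Set.eq_empty_of_forall_notMem ?_)).trans (Set.ncard_empty _)
  rintro e ⟨h1, h2⟩
  exact (D.isLink e).ne (h1.trans h2.symm)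

theorem Orientation.outDegree_eq_sum (hv : Function.Injective v)
    (hV : Set.range v = G.vertexSet) (hE : G.edgeSet.Finite) (D : G.Orientation) (x : α) :
    D.outDegree x = ∑ j, D.arcCount x (v j) := by
  have := hE.to_subtype
  refine ncard_eq_sum_of_iUnion (Set.toFinite _) ?_ ?_
  · ext e
    simp only [Set.mem_ofPred_eq, Set.mem_iUnion, exists_and_left, iff_self_and]
    intro _
    obtain ⟨j, hj⟩ := hV.symm ▸ (D.isLink e).right_mem
    exact ⟨j, hj.symm⟩
  · intro j k hjk
    refine Set.disjoint_left.2 ?_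
    rintro e ⟨-, h1⟩ ⟨-, h2⟩
    exact hjk (hv (h1.symm.trans h2))

theorem Orientation.inDegree_eq_sum (hv : Function.Injective v)
    (hV : Set.range v = G.vertexSet) (hE : G.edgeSet.Finite) (D : G.Orientation) (x : α) :
    D.inDegree x = ∑ j, D.arcCount (v j) x := by
  have := hE.to_subtype
  refine ncard_eq_sum_of_iUnion (Set.toFinite _) ?_ ?_
  · ext e
    simp only [Set.mem_ofPred_eq, Set.mem_iUnion, exists_and_right, iff_and_self]
    intro _
    obtain ⟨j, hj⟩ := hV.symm ▸ (D.isLink e).left_mem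
    exact ⟨j, hj.symm⟩
  · intro j k hjk
    refine Set.disjoint_left.2 ?_
    rintro e ⟨h1, -⟩ ⟨h2, -⟩
    exact hjk (hv (h1.symm.trans h2))

theorem exists_orientation_arcCount [G.Loopless] (hv : Function.Injective v)
    (hV : Set.range v = G.vertexSet) (y : Fin 4 → Fin 4 → ℕ)
    (hy : ∀ i j, i < j → y i j ≤ G.pairMultiplicity (v i) (v j)) :
    ∃ D : G.Orientation, ∀ i j, i < j → D.arcCount (v i) (v j) = y i j := by
  classical
  -- `T i j` collects the edges to be directed from the lower to the higher index; all others go the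
  -- opposite way.
  have hT : ∀ i j, ∃ T : Set β, T ⊆ {e | G.IsLink e (v i) (v j)} ∧ (i < j → T.ncard = y i j) := by
    intro i j
    by_cases hij : i < j
    · obtain ⟨T, hT, hc⟩ := Set.exists_subset_card_eq (pairMultiplicity_eq_ncard _ _ ▸ hy i j hij)
      exact ⟨T, hT, fun _ ↦ hc⟩
    · exact ⟨∅, Set.empty_subset _, fun h ↦ absurd h hij⟩
  choose T hT hc using hT
  choose a b hab hlink using fun e : G.edgeSet ↦ exists_isLink_lt hV e.2
  have hT_iff : ∀ (e : G.edgeSet) i j, i < j → e.1 ∈ T i j → a e = i ∧ b e = j := by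
    intro e i j hij he
    rcases (hlink e).eq_and_eq_or_eq_and_eq (hT i j he) with h | h <;> rw [hv.eq_iff, hv.eq_iff] at h
    · exact h
    · exact absurd (hab e) (by rw [h.1, h.2]; exact hij.not_gt)
  refine ⟨⟨fun e ↦ if e.1 ∈ T (a e) (b e) then v (a e) else v (b e),
    fun e ↦ if e.1 ∈ T (a e) (b e) then v (b e) else v (a e), fun e ↦ ?_⟩, fun i j hij ↦ ?_⟩
  · split_ifs
    · exact hlink e
    · exact (hlink e).symm
  · rw [← hc i j hij, ← Set.ncard_preimage_of_injective_subset_range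
      (Subtype.val_injective (p := (· ∈ G.edgeSet))), Orientation.arcCount]
    · congr 1
      ext e
      simp only [Set.mem_ofPred_eq, Set.mem_preimage]
      constructor
      · split_ifs with he <;> rw [hv.eq_iff, hv.eq_iff]
        · rintro ⟨rfl, rfl⟩
          exact he
        · rintro ⟨rfl, rfl⟩
          exact absurd (hab e) hij.not_gt
      · intro he
        obtain ⟨rfl, rfl⟩ := hT_iff e i j hij he
        simp [he]
    · intro e he
      exact ⟨⟨e, (hT i j he).edge_mem⟩, rfl⟩

end Graph

/-! ### Strong connectivity as a covering property of flows. -/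

namespace Graph
variable {α β : Type*} {G : Graph α β} {v : Fin 4 → α} {ℓ : ℕ}

theorem Orientation.isBoundaryOrientation_iff [G.Loopless] (hv : Function.Injective v)
    (hV : Set.range v = G.vertexSet) (hE : G.edgeSet.Finite) (D : G.Orientation) (b : α → ℕ) :
    D.IsBoundaryOrientation ℓ b ↔ ∀ i, 2 * (ℓ : ℤ) ∣
      ∑ j, ((D.arcCount (v i) (v j) : ℤ) - D.arcCount (v j) (v i)) - b (v i) := by
  rw [IsBoundaryOrientation, ← hV, Set.forall_mem_range]
  refine forall_congr' fun i ↦ ?_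
  rw [D.outDegree_eq_sum hv hV hE, D.inDegree_eq_sum hv hV hE, Int.modEq_comm,
    Int.modEq_iff_dvd, Finset.sum_sub_distrib]
  push_cast
  rfl

theorem isBoundary_iff [G.Loopless] (hv : Function.Injective v)
    (hV : Set.range v = G.vertexSet) (hE : G.edgeSet.Finite) (b : α → ℕ) :
    G.IsBoundary ℓ b ↔ (∀ i, b (v i) < 2 * ℓ) ∧
      (∀ i, (2 : ℤ) ∣ b (v i) - ∑ j, (G.pairMultiplicity (v i) (v j) : ℤ)) ∧
      2 * (ℓ : ℤ) ∣ ∑ i, (b (v i) : ℤ) := by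
  have hsum : ∑ᶠ x ∈ G.vertexSet, b x = ∑ i, b (v i) := by
    rw [← hV, finsum_mem_range hv, finsum_eq_sum_of_fintype]
  have hpar : ∀ i, b (v i) ≡ G.vertexDegree (v i) [MOD 2] ↔
      (2 : ℤ) ∣ b (v i) - ∑ j, (G.pairMultiplicity (v i) (v j) : ℤ) := by
    intro i
    rw [Nat.ModEq.comm, Nat.modEq_iff_dvd, vertexDegree_eq_sum hv hV hE]
    push_cast
    rfl
  have hsum' : ∑ i, b (v i) ≡ 0 [MOD 2 * ℓ] ↔ 2 * (ℓ : ℤ) ∣ ∑ i, (b (v i) : ℤ) := by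
    rw [Nat.modEq_zero_iff_dvd, ← Int.natCast_dvd_natCast]
    push_cast
    rfl
  rw [← hsum', ← hsum]
  simp_rw [← hpar]
  constructor
  · rintro ⟨h1, h2, h3⟩
    exact ⟨fun i ↦ h1 _ (hV ▸ ⟨i, rfl⟩), fun i ↦ h2 _ (hV ▸ ⟨i, rfl⟩), h3⟩
  · rintro ⟨h1, h2, h3⟩
    exact ⟨hV ▸ Set.forall_mem_range.2 h1, hV ▸ Set.forall_mem_range.2 h2, h3⟩

theorem stronglyZConnected_iff_flowsCover [G.Loopless] (hℓ : 0 < ℓ) (hv : Function.Injective v)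
    (hV : Set.range v = G.vertexSet) (hE : G.edgeSet.Finite) :
    G.StronglyZConnected ℓ ↔ FlowsCover ℓ (G.pairMultiplicity (v 0) (v 1))
      (G.pairMultiplicity (v 0) (v 2)) (G.pairMultiplicity (v 0) (v 3))
      (G.pairMultiplicity (v 1) (v 2)) (G.pairMultiplicity (v 1) (v 3))
      (G.pairMultiplicity (v 2) (v 3)) := by
  have hadd : ∀ (D : G.Orientation) i j, i ≠ j → (D.arcCount (v j) (v i) : ℤ) =
      G.pairMultiplicity (v i) (v j) - D.arcCount (v i) (v j) := by
    intro D i j hij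
    have := D.arcCount_add_arcCount hE (hv.ne hij)
    omega
  have hself : ∀ (D : G.Orientation) i, D.arcCount (v i) (v i) = 0 := fun D i ↦ D.arcCount_self _
  have hb : ∀ (D : G.Orientation) (b : α → ℕ), D.IsBoundaryOrientation ℓ b ↔
      2 * (ℓ : ℤ) ∣ (2 * (D.arcCount (v 0) (v 1) + D.arcCount (v 0) (v 2) + D.arcCount (v 0) (v 3))
        - (G.pairMultiplicity (v 0) (v 1) + G.pairMultiplicity (v 0) (v 2) +
          G.pairMultiplicity (v 0) (v 3))) - b (v 0) ∧
      2 * (ℓ : ℤ) ∣ (2 * (D.arcCount (v 1) (v 2) + D.arcCount (v 1) (v 3) - D.arcCount (v 0) (v 1))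
        - (G.pairMultiplicity (v 1) (v 2) + G.pairMultiplicity (v 1) (v 3) -
          G.pairMultiplicity (v 0) (v 1))) - b (v 1) ∧
      2 * (ℓ : ℤ) ∣ (2 * (D.arcCount (v 2) (v 3) - D.arcCount (v 0) (v 2) - D.arcCount (v 1) (v 2))
        - (G.pairMultiplicity (v 2) (v 3) - G.pairMultiplicity (v 0) (v 2) -
          G.pairMultiplicity (v 1) (v 2))) - b (v 2) ∧
      2 * (ℓ : ℤ) ∣ (2 * (- D.arcCount (v 0) (v 3) - D.arcCount (v 1) (v 3) -
          D.arcCount (v 2) (v 3))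
        - (- G.pairMultiplicity (v 0) (v 3) - G.pairMultiplicity (v 1) (v 3) -
          G.pairMultiplicity (v 2) (v 3))) - b (v 3) := by
    intro D b
    rw [D.isBoundaryOrientation_iff hv hV hE]
    simp only [Fin.forall_fin_succ, Fin.sum_univ_four, sub_self, Fin.succ_zero_eq_one,
      Fin.succ_one_eq_two, IsEmpty.forall_iff, and_true]
    simp only [show (Fin.succ 2 : Fin 4) = 3 from rfl, hadd D 0 1 (by decide),
      hadd D 0 2 (by decide), hadd D 0 3 (by decide), hadd D 1 2 (by decide),
      hadd D 1 3 (by decide), hadd D 2 3 (by decide)]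
    refine and_congr ?_ (and_congr ?_ (and_congr ?_ ?_)) <;> ring_nf
  -- Signs do not matter modulo 2, so degrees may be replaced by the signed sums that occur in `hb`.
  have hdeg : ∀ b : α → ℕ,
      (∀ i, (2 : ℤ) ∣ b (v i) - ∑ j, (G.pairMultiplicity (v i) (v j) : ℤ)) ↔
      (2 : ℤ) ∣ b (v 0) - (G.pairMultiplicity (v 0) (v 1) + G.pairMultiplicity (v 0) (v 2) +
          G.pairMultiplicity (v 0) (v 3)) ∧
      (2 : ℤ) ∣ b (v 1) - (G.pairMultiplicity (v 1) (v 2) + G.pairMultiplicity (v 1) (v 3) -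
          G.pairMultiplicity (v 0) (v 1)) ∧
      (2 : ℤ) ∣ b (v 2) - (G.pairMultiplicity (v 2) (v 3) - G.pairMultiplicity (v 0) (v 2) -
          G.pairMultiplicity (v 1) (v 2)) ∧
      (2 : ℤ) ∣ b (v 3) - (- G.pairMultiplicity (v 0) (v 3) - G.pairMultiplicity (v 1) (v 3) -
          G.pairMultiplicity (v 2) (v 3)) := by
    intro b
    simp only [Fin.forall_fin_succ, Fin.sum_univ_four, Fin.succ_zero_eq_one,
      Fin.succ_one_eq_two, IsEmpty.forall_iff, and_true]
    simp only [show (Fin.succ 2 : Fin 4) = 3 from rfl, pairMultiplicity_self,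
      pairMultiplicity_comm (v 1) (v 0), pairMultiplicity_comm (v 2) (v 0),
      pairMultiplicity_comm (v 3) (v 0), pairMultiplicity_comm (v 2) (v 1),
      pairMultiplicity_comm (v 3) (v 1), pairMultiplicity_comm (v 3) (v 2)]
    refine and_congr ?_ (and_congr ?_ (and_congr ?_ ?_)) <;> omega
  constructor
  · intro h g₁ g₂ g₃ g₄ hg
    let r : Fin 4 → ℤ := ![2 * g₁ - (G.pairMultiplicity (v 0) (v 1) +
        G.pairMultiplicity (v 0) (v 2) + G.pairMultiplicity (v 0) (v 3)),
      2 * g₂ - (G.pairMultiplicity (v 1) (v 2) + G.pairMultiplicity (v 1) (v 3) -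
        G.pairMultiplicity (v 0) (v 1)),
      2 * g₃ - (G.pairMultiplicity (v 2) (v 3) - G.pairMultiplicity (v 0) (v 2) -
        G.pairMultiplicity (v 1) (v 2)),
      2 * g₄ - (- G.pairMultiplicity (v 0) (v 3) - G.pairMultiplicity (v 1) (v 3) -
        G.pairMultiplicity (v 2) (v 3))]
    have hr : ∀ i, ∃ n : ℕ, n < 2 * ℓ ∧ ∃ k, (n : ℤ) = r i + 2 * ℓ * k := by
      intro i
      have h0 : (0 : ℤ) < 2 * ℓ := by omega
      obtain ⟨n, hn⟩ := Int.eq_ofNat_of_zero_le (Int.emod_nonneg (r i) h0.ne')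
      refine ⟨n, ?_, -(r i / (2 * ℓ)), ?_⟩
      · have := Int.emod_lt_of_pos (r i) h0
        omega
      · have := Int.emod_add_mul_ediv (r i) (2 * ℓ)
        linarith
    choose n hn k hk using hr
    -- The value `0` off the vertex set is arbitrary.
    obtain ⟨b, hbv⟩ : ∃ b : α → ℕ, ∀ i, b (v i) = n i :=
      ⟨Function.extend v n 0, fun i ↦ hv.extend_apply _ _ _⟩
    have e₀ : (n 0 : ℤ) = _ := hk 0
    have e₁ : (n 1 : ℤ) = _ := hk 1
    have e₂ : (n 2 : ℤ) = _ := hk 2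
    have e₃ : (n 3 : ℤ) = _ := hk 3
    simp only [r, Matrix.cons_val] at e₀ e₁ e₂ e₃
    have hbound : G.IsBoundary ℓ b := by
      rw [isBoundary_iff hv hV hE, hdeg]
      simp only [hbv, Fin.sum_univ_four, e₀, e₁, e₂, e₃]
      have even : ∀ g c k : ℤ, 2 ∣ 2 * g - c + 2 * ℓ * k - c :=
        fun g c k ↦ ⟨g - c + ℓ * k, by ring⟩
      refine ⟨hn, ⟨even _ _ _, even _ _ _, even _ _ _, even _ _ _⟩, ?_⟩
      obtain ⟨s, hs⟩ := hg
      exact ⟨s + k 0 + k 1 + k 2 + k 3, by linear_combination 2 * hs⟩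
    obtain ⟨D, hD⟩ := h b hbound
    rw [hb] at hD
    simp only [hbv, e₀, e₁, e₂, e₃] at hD
    obtain ⟨⟨q₀, h₀⟩, ⟨q₁, h₁⟩, ⟨q₂, h₂⟩, q₃, h₃⟩ := hD
    have le : ∀ i j, i ≠ j → (0 : ℤ) ≤ D.arcCount (v i) (v j) ∧
        (D.arcCount (v i) (v j) : ℤ) ≤ G.pairMultiplicity (v i) (v j) := by
      intro i j hij
      have := hadd D i j hij
      omega
    exact ⟨D.arcCount (v 0) (v 1), D.arcCount (v 0) (v 2), D.arcCount (v 0) (v 3),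
      D.arcCount (v 1) (v 2), D.arcCount (v 1) (v 3), D.arcCount (v 2) (v 3),
      ⟨le _ _ (by decide), le _ _ (by decide), le _ _ (by decide), le _ _ (by decide),
        le _ _ (by decide), le _ _ (by decide)⟩,
      ⟨q₀ + k 0, by linarith⟩, ⟨q₁ + k 1, by linarith⟩, ⟨q₂ + k 2, by linarith⟩,
      ⟨q₃ + k 3, by linarith⟩⟩
  · intro h b hbound
    rw [isBoundary_iff hv hV hE, hdeg, Fin.sum_univ_four] at hbound
    obtain ⟨-, ⟨⟨g₁, e₁⟩, ⟨g₂, e₂⟩, ⟨g₃, e₃⟩, g₄, e₄⟩, s, hs⟩ := hbound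
    -- Parity gives `b = c + 2g` with `c` the signed sum; the net out-degree `2y - c` is `b` modulo
    -- `2ℓ` exactly when the flow `y` is `g + c` modulo `ℓ`.
    obtain ⟨y₁₂, y₁₃, y₁₄, y₂₃, y₂₄, y₃₄, ⟨b₁₂, b₁₃, b₁₄, b₂₃, b₂₄, b₃₄⟩, ⟨q₁, h₁⟩, ⟨q₂, h₂⟩,
      ⟨q₃, h₃⟩, q₄, h₄⟩ := h
      (g₁ + (G.pairMultiplicity (v 0) (v 1) + G.pairMultiplicity (v 0) (v 2) +
        G.pairMultiplicity (v 0) (v 3)))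
      (g₂ + (G.pairMultiplicity (v 1) (v 2) + G.pairMultiplicity (v 1) (v 3) -
        G.pairMultiplicity (v 0) (v 1)))
      (g₃ + (G.pairMultiplicity (v 2) (v 3) - G.pairMultiplicity (v 0) (v 2) -
        G.pairMultiplicity (v 1) (v 2)))
      (g₄ + (- G.pairMultiplicity (v 0) (v 3) - G.pairMultiplicity (v 1) (v 3) -
        G.pairMultiplicity (v 2) (v 3))) ⟨s, by linarith⟩
    obtain ⟨D, hD⟩ := exists_orientation_arcCount hv hV
      ![![0, y₁₂.toNat, y₁₃.toNat, y₁₄.toNat], ![0, 0, y₂₃.toNat, y₂₄.toNat],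
        ![0, 0, 0, y₃₄.toNat], ![0, 0, 0, 0]] (by
        intro i j hij
        fin_cases i <;> fin_cases j <;> simp at hij ⊢ <;> omega)
    refine ⟨D, (hb D b).2 ?_⟩
    have a₁₂ : D.arcCount (v 0) (v 1) = y₁₂.toNat := hD 0 1 (by decide)
    have a₁₃ : D.arcCount (v 0) (v 2) = y₁₃.toNat := hD 0 2 (by decide)
    have a₁₄ : D.arcCount (v 0) (v 3) = y₁₄.toNat := hD 0 3 (by decide)
    have a₂₃ : D.arcCount (v 1) (v 2) = y₂₃.toNat := hD 1 2 (by decide)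
    have a₂₄ : D.arcCount (v 1) (v 3) = y₂₄.toNat := hD 1 3 (by decide)
    have a₃₄ : D.arcCount (v 2) (v 3) = y₃₄.toNat := hD 2 3 (by decide)
    rw [a₁₂, a₁₃, a₁₄, a₂₃, a₂₄, a₃₄, Int.toNat_of_nonneg b₁₂.1, Int.toNat_of_nonneg b₁₃.1,
      Int.toNat_of_nonneg b₁₄.1, Int.toNat_of_nonneg b₂₃.1, Int.toNat_of_nonneg b₂₄.1,
      Int.toNat_of_nonneg b₃₄.1]
    exact ⟨⟨q₁, by linarith⟩, ⟨q₂, by linarith⟩, ⟨q₃, by linarith⟩, ⟨q₄, by linarith⟩⟩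

/-- The pairs `x = y` admitted in `multiplicity` contribute `0`, so positivity of `n` makes them
harmless. -/
theorem multiplicity_eq_iff [G.Loopless] (hV : Set.range v = G.vertexSet) {n : ℕ} (hn : 0 < n)
    (hle : ∀ i j, G.pairMultiplicity (v i) (v j) ≤ n) :
    G.multiplicity = n ↔ ∃ i j, i < j ∧ G.pairMultiplicity (v i) (v j) = n := by
  have hset : {m | ∃ x ∈ G.vertexSet, ∃ y ∈ G.vertexSet, G.pairMultiplicity x y = m} =
      {m | ∃ i j, G.pairMultiplicity (v i) (v j) = m} := by
    ext m
    simp only [← hV, Set.mem_ofPred_eq, Set.exists_range_iff]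
  have hmem : n ∈ upperBounds {m | ∃ i j, G.pairMultiplicity (v i) (v j) = m} := by
    rintro _ ⟨i, j, rfl⟩
    exact hle i j
  have hne : {m | ∃ i j, G.pairMultiplicity (v i) (v j) = m}.Nonempty := ⟨_, 0, 0, rfl⟩
  rw [multiplicity, hset]
  constructor
  · intro h
    obtain ⟨i, j, hij⟩ := h ▸ Nat.sSup_mem hne ⟨n, hmem⟩
    rcases lt_trichotomy i j with hlt | rfl | hlt
    · exact ⟨i, j, hlt, hij⟩
    · rw [pairMultiplicity_self] at hij
      omega
    · exact ⟨j, i, hlt, pairMultiplicity_comm (v i) (v j) ▸ hij⟩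
  · rintro ⟨i, j, -, h⟩
    exact le_antisymm (csSup_le hne hmem) (le_csSup ⟨n, hmem⟩ ⟨i, j, h⟩)

theorem le_minVertexDegree_iff (hV : Set.range v = G.vertexSet) {n : ℕ} :
    n ≤ G.minVertexDegree ↔ ∀ i, n ≤ G.vertexDegree (v i) := by
  have hne : (G.vertexDegree '' Set.range v).Nonempty := ⟨_, v 0, ⟨0, rfl⟩, rfl⟩
  rw [minVertexDegree, ← hV, le_csInf_iff'' hne, Set.forall_mem_image, Set.forall_mem_range]

theorem exists_setDegree_ne_iff (hv : Function.Injective v) (hV : Set.range v = G.vertexSet)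
    {n : ℕ} : (∃ S : Set α, S ⊆ G.vertexSet ∧ S.ncard = 2 ∧ G.setDegree S ≠ n) ↔
      ∃ T : Finset (Fin 4), T.card = 2 ∧ G.setDegree (v '' T) ≠ n := by
  constructor
  · rintro ⟨S, hS, hc, hn⟩
    obtain ⟨T, rfl⟩ := Set.subset_range_iff_exists_image_eq.1 (hV ▸ hS)
    rw [Set.ncard_image_of_injective _ hv] at hc
    refine ⟨T.toFinite.toFinset, ?_, by simpa using hn⟩
    rw [← Set.ncard_coe_finset]
    simpa using hc
  · rintro ⟨T, hc, hn⟩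
    refine ⟨v '' T, hV ▸ Set.image_subset_range v T, ?_, hn⟩
    rw [Set.ncard_image_of_injective _ hv, Set.ncard_coe_finset, hc]

end Graph

/-! ### Explicit parameters and the theorem. -/

namespace Graph
variable {α β : Type*} {G : Graph α β} {v : Fin 4 → α}

theorem exists_range_eq_vertexSet (h : G.vertexSet.ncard = 4) :
    ∃ v : Fin 4 → α, Function.Injective v ∧ Set.range v = G.vertexSet := by
  have : Finite G.vertexSet := Set.finite_of_ncard_ne_zero (by omega)
  let e : G.vertexSet ≃ Fin 4 := Finite.equivFinOfCardEq h
  refine ⟨fun i ↦ e.symm i, Subtype.val_injective.comp e.symm.injective, ?_⟩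
  rw [show (fun i ↦ (e.symm i : α)) = Subtype.val ∘ e.symm from rfl, Set.range_comp,
    e.symm.surjective.range_eq, Set.image_univ, Subtype.range_coe]

theorem vertexDegree_explicit [G.Loopless] (hv : Function.Injective v)
    (hV : Set.range v = G.vertexSet) (hE : G.edgeSet.Finite) :
    G.vertexDegree (v 0) = G.pairMultiplicity (v 0) (v 1) + G.pairMultiplicity (v 0) (v 2) +
        G.pairMultiplicity (v 0) (v 3) ∧
      G.vertexDegree (v 1) = G.pairMultiplicity (v 0) (v 1) + G.pairMultiplicity (v 1) (v 2) +
        G.pairMultiplicity (v 1) (v 3) ∧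
      G.vertexDegree (v 2) = G.pairMultiplicity (v 0) (v 2) + G.pairMultiplicity (v 1) (v 2) +
        G.pairMultiplicity (v 2) (v 3) ∧
      G.vertexDegree (v 3) = G.pairMultiplicity (v 0) (v 3) + G.pairMultiplicity (v 1) (v 3) +
        G.pairMultiplicity (v 2) (v 3) := by
  simp only [vertexDegree_eq_sum hv hV hE, Fin.sum_univ_four, pairMultiplicity_self,
      pairMultiplicity_comm (v 1) (v 0), pairMultiplicity_comm (v 2) (v 0),
      pairMultiplicity_comm (v 3) (v 0), pairMultiplicity_comm (v 2) (v 1),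
      pairMultiplicity_comm (v 3) (v 1), pairMultiplicity_comm (v 3) (v 2)]
  omega

theorem numEdges_explicit [G.Loopless] (hv : Function.Injective v)
    (hV : Set.range v = G.vertexSet) (hE : G.edgeSet.Finite) :
    G.numEdges = G.pairMultiplicity (v 0) (v 1) + G.pairMultiplicity (v 0) (v 2) +
      G.pairMultiplicity (v 0) (v 3) + G.pairMultiplicity (v 1) (v 2) +
      G.pairMultiplicity (v 1) (v 3) + G.pairMultiplicity (v 2) (v 3) := by
  simp [numEdges_eq_sum hv hV hE, Fin.sum_univ_four]
  omega

theorem exists_setDegree_ne_iff_explicit (hv : Function.Injective v)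
    (hV : Set.range v = G.vertexSet) (hE : G.edgeSet.Finite) {n : ℕ} :
    (∃ S : Set α, S ⊆ G.vertexSet ∧ S.ncard = 2 ∧ G.setDegree S ≠ n) ↔
      ¬ (G.pairMultiplicity (v 0) (v 2) + G.pairMultiplicity (v 0) (v 3) +
          G.pairMultiplicity (v 1) (v 2) + G.pairMultiplicity (v 1) (v 3) = n ∧
        G.pairMultiplicity (v 0) (v 1) + G.pairMultiplicity (v 0) (v 3) +
          G.pairMultiplicity (v 1) (v 2) + G.pairMultiplicity (v 2) (v 3) = n ∧
        G.pairMultiplicity (v 0) (v 1) + G.pairMultiplicity (v 0) (v 2) +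
          G.pairMultiplicity (v 1) (v 3) + G.pairMultiplicity (v 2) (v 3) = n) := by
  have hT : ∀ T : Finset (Fin 4), T.card = 2 ↔
      (T = {0, 1} ∨ T = {2, 3}) ∨ (T = {0, 2} ∨ T = {1, 3}) ∨ T = {0, 3} ∨ T = {1, 2} := by
    decide
  rw [exists_setDegree_ne_iff hv hV]
  simp only [hT, or_and_right, exists_or, exists_eq_left, setDegree_image_eq_sum hv hV hE,
    Fin.sum_univ_four]
  simp only [Finset.mem_insert, Finset.mem_singleton, Fin.reduceEq, or_false, or_true, or_self,
    not_true_eq_false, not_false_eq_true, and_true, and_false, if_true, if_false,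
    pairMultiplicity_comm (v 1) (v 0), pairMultiplicity_comm (v 2) (v 0),
    pairMultiplicity_comm (v 3) (v 0), pairMultiplicity_comm (v 2) (v 1),
    pairMultiplicity_comm (v 3) (v 1), pairMultiplicity_comm (v 3) (v 2)]
  omega

end Graph

theorem mainTheorem2 {α β γ : Type*} (ℓ : ℕ) (hℓ : 2 ≤ ℓ)
    (G₀ : Graph α β) (hG₀ : G₀.Loopless) (hE : G₀.edgeSet.Finite) (hV : G₀.vertexSet.ncard = 4)
    (G : Graph α γ) (hG : Graph.IsSimplifiedGraph ℓ G₀ G) :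
    G₀.StronglyZConnected ℓ ↔
      ℓ - 1 ≤ G.minVertexDegree ∧
      3 * ℓ - 3 ≤ G.numEdges ∧
      ((G.multiplicity = ℓ - 1 ∨ 3 * ℓ - 2 ≤ G.numEdges) ∨
        (∃ S : Set α, S ⊆ G.vertexSet ∧ S.ncard = 2 ∧ G.setDegree S ≠ 2 * ℓ - 2) ∨
        (∃ v ∈ G.vertexSet, ¬ G.vertexDegree v ≡ ℓ [MOD 2])) := by
  obtain ⟨v, hv, hv₀⟩ := Graph.exists_range_eq_vertexSet hV
  have hvG : Set.range v = G.vertexSet := hv₀.trans hG.vertexSet_eq.symm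
  have hloop := hG.loopless
  have hEG := hG.edgeSet_finite
  have hmin : ∀ i j, i ≠ j → G.pairMultiplicity (v i) (v j) =
      min (G₀.pairMultiplicity (v i) (v j)) (ℓ - 1) := fun i j hij ↦
    hG.pairMultiplicity_eq _ (hv₀ ▸ ⟨i, rfl⟩) _ (hv₀ ▸ ⟨j, rfl⟩) (hv.ne hij)
  have hcast : ∀ i j, i ≠ j → min (G₀.pairMultiplicity (v i) (v j) : ℤ) (ℓ - 1) =
      G.pairMultiplicity (v i) (v j) := by
    intro i j hij
    have := hmin i j hij
    omega
  have hle : ∀ i j, G.pairMultiplicity (v i) (v j) ≤ ℓ - 1 := by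
    intro i j
    by_cases hij : i = j
    · rw [hij, Graph.pairMultiplicity_self]
      exact Nat.zero_le _
    · exact hmin i j hij ▸ min_le_right _ _
  have hle' : ∀ i j, (G.pairMultiplicity (v i) (v j) : ℤ) ≤ ℓ - 1 := by
    intro i j
    have := hle i j
    omega
  -- Truncating the multiplicities of `G₀` gives those of `G`, so the criterion is applied to `G`,
  -- whose edges may differ from those of `G₀`.
  rw [Graph.stronglyZConnected_iff_flowsCover (by omega) hv hv₀ hE,
    ← Graph.flowsCover_min_iff (by omega), hcast 0 1 (by decide), hcast 0 2 (by decide),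
    hcast 0 3 (by decide), hcast 1 2 (by decide), hcast 1 3 (by decide), hcast 2 3 (by decide),
    Graph.flowsCover_iff (by omega) (by simp) (by simp [hle'])]
  obtain ⟨d₀, d₁, d₂, d₃⟩ := Graph.vertexDegree_explicit hv hvG hEG
  have hmult : G.multiplicity = ℓ - 1 ↔
      ((G.pairMultiplicity (v 0) (v 1) = ℓ - 1 ∨ G.pairMultiplicity (v 0) (v 2) = ℓ - 1 ∨
        G.pairMultiplicity (v 0) (v 3) = ℓ - 1) ∨ G.pairMultiplicity (v 1) (v 2) = ℓ - 1 ∨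
        G.pairMultiplicity (v 1) (v 3) = ℓ - 1 ∨ G.pairMultiplicity (v 2) (v 3) = ℓ - 1) := by
    rw [Graph.multiplicity_eq_iff hvG (by omega) hle]
    simp [Fin.exists_fin_succ, or_assoc]
  have hpar : (∃ x ∈ G.vertexSet, ¬ G.vertexDegree x ≡ ℓ [MOD 2]) ↔
      ¬ ((G.vertexDegree (v 0) ≡ ℓ [MOD 2] ∧ G.vertexDegree (v 1) ≡ ℓ [MOD 2]) ∧
        G.vertexDegree (v 2) ≡ ℓ [MOD 2] ∧ G.vertexDegree (v 3) ≡ ℓ [MOD 2]) := by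
    rw [← hvG, Set.exists_range_iff]
    simp only [Fin.exists_fin_succ]
    simp only [Fin.succ_zero_eq_one, Fin.succ_one_eq_two, show (Fin.succ 2 : Fin 4) = 3 from rfl,
      IsEmpty.exists_iff, or_false]
    tauto
  rw [Graph.le_minVertexDegree_iff hvG, Graph.numEdges_explicit hv hvG hEG, hmult,
    Graph.exists_setDegree_ne_iff_explicit hv hvG hEG, hpar]
  refine and_congr ?_ (and_congr ?_ (or_congr (or_congr ?_ ?_) (or_congr ?_ ?_)))
  · simp only [Fin.forall_fin_succ, Fin.succ_zero_eq_one, Fin.succ_one_eq_two,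
      show (Fin.succ 2 : Fin 4) = 3 from rfl, IsEmpty.forall_iff, and_true, d₀, d₁, d₂, d₃]
    omega
  · omega
  · omega
  · omega
  · omega
  · simp only [d₀, d₁, d₂, d₃, Nat.ModEq]
    omega
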